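/- Throughout $2<n<\omega$. An algebra in $\mathsf{PEA}_n$ (resp. $\mathsf{QEA}_\omega$) is a quasi-polyadic equality algebra of dimension $n$ (resp. $\omega$): a Boolean algebra with cylindrifiers $\mathsf c_i$, diagonal elements $\mathsf d_{ij}$ and substitutions $\mathsf s_\tau$ for the finite transformations $\tau$ of the dimension, satisfying the usual axioms. Let $\alpha$ be a $\mathsf{PEA}_n$ atom structure, i.e. $\alpha\cong\mathsf{At}\,\mathfrak A$ for an atomic $\mathfrak A\in\mathsf{PEA}_n$; $\mathfrak{Cm}\,\alpha$ is its complex algebra. For $\mathfrak D\in\mathsf{QEA}_\omega$, $\mathfrak{Nr}_n\mathfrak D$ is the neat $n$-reduct, with universe $\{x:\mathsf c_ix=x\text{ for all }i\ge n\}$; $\mathfrak D$ is locally finite if $\{i:\mathsf c_ix\ne x\}$ is finite for every $x$, and complete if all suprema exist. *Networks.* A network over $\alpha$ is a map $N:{}^n\Delta\to\alpha$, where $\Delta=\mathrm{nodes}(N)$ is a non-empty finite subset of $\omega$, such that $N(\delta[i\to\delta_j])\le\mathsf d_{ij}$, $N(\delta[i\to d])\le\mathsf c_iN(\delta)$ and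 $N(\delta\circ[i,j])=\mathsf s_{[i,j]}N(\delta)$ for all $\delta\in{}^n\Delta$, $d\in\Delta$, $i,j<n$. For nodes $x,y$ put $x\sim y$ if $N(x,y,\bar z)\le\mathsf d_{01}$ for some $\bar z$, and extend $\sim$ to finite sequences of equal length entrywise. Let $\Lambda$ be a set of hyperlabels and $\lambda\in\Lambda$. A hypernetwork is a network $N$ together with a labelling $N^h$ of all finite sequences of nodes by elements of $\Lambda$ such that $\bar x\sim\bar y$ implies $N(\bar x)=N(\bar y)$ for $n$-tuples of nodes and $N^h(\bar x)=N^h(\bar y)$ for finite sequences of nodes. A finite sequence of nodes is short if there are nodes $y_0,\dots,y_{n-1}$ such that each of its entries is $\sim$ to some $y_j$. A hypernetwork is $\lambda$-neat if $N^h(\bar x)=\lambda$ for every short $\bar x$. *The game $J$ on $\alpha$* (with hyperlabels $\Lambda$ and label $\lambda$) has $\omega$ rounds. In each round $\exists$ must respond with a $\lambda$-neat hypernetwork, as follows. In the initial round $\forall$ picks $a\in\alpha$, and $\exists$ must play $N$ with $N(\bar d)=a$ for some $\bar d\in{}^n\mathrm{nodes}(N)$. In each later round $\forall$ makes one of the following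 moves. 1. Cylindrifier move: he picks a previously played $N$, $l<n$, $f\in{}^n\mathrm{nodes}(N)$, $k\in\omega\setminus\mathrm{nodes}(N)$ and $b\in\alpha$ with $b\le\mathsf c_lN(f)$. She must play $M\supseteq N$ with $\mathrm{nodes}(M)=\mathrm{nodes}(N)\cup\{k\}$ and $M(f[l\to k])=b$. 2. Transformation move: he picks a previously played $N$ and a finite partial surjection $\theta$ from $\omega$ onto $\mathrm{nodes}(N)$. She must play $N\theta$, whose set of nodes is $\mathrm{dom}\,\theta$ and whose labels are given by $(N\theta)(\bar x)=N(\theta\bar x)$ and $(N\theta)^h(\bar x)=N^h(\theta\bar x)$. 3. Amalgamation move: he picks previously played $M,N$ with $\mathrm{nodes}(M)\cap\mathrm{nodes}(N)\neq\emptyset$ that agree (atom labels and hyperlabels) on $\mathrm{nodes}(M)\cap\mathrm{nodes}(N)$. She must play $L$ extending both, with $\mathrm{nodes}(L)=\mathrm{nodes}(M)\cup\mathrm{nodes}(N)$. $\exists$ wins a play if she makes a legal response in every round. **Theorem.** Let $2<n<\omega$, let $\alpha$ be a $\mathsf{PEA}_n$ atom structure with countably many atoms, let $\Lambda$ be any set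 and $\lambda\in\Lambda$. If $\exists$ has a winning strategy in $J$ on $\alpha$, then: 1. there is a locally finite $\mathfrak D\in\mathsf{QEA}_\omega$ such that $\mathfrak{Nr}_n\mathfrak D$ is atomic and $\alpha\cong\mathsf{At}\,\mathfrak{Nr}_n\mathfrak D$, and moreover $\mathfrak{Cm}\,\alpha\cong\mathfrak{Nr}_n\mathfrak D$ (so that $\mathfrak{Nr}_n\mathfrak D$ is complete); 2. there is a complete (not necessarily locally finite) $\mathfrak D\in\mathsf{QEA}_\omega$ such that $\mathfrak{Nr}_n\mathfrak D$ is atomic, $\alpha\cong\mathsf{At}\,\mathfrak{Nr}_n\mathfrak D$ and $\mathfrak{Cm}\,\alpha\cong\mathfrak{Nr}_n\mathfrak D$. -/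

import Mathlib

universe u v w

/-! ### Quasi-polyadic equality algebras -/

/-- The finite transformations of `ι`: the maps that move only finitely many points. -/
def FinTrans (ι : Type v) : Type v := {τ : ι → ι // {i | τ i ≠ i}.Finite}

namespace FinTrans

/-- The identity transformation. -/
def one (ι : Type v) : FinTrans ι := ⟨id, by simp⟩

/-- Composition `σ ∘ τ` (first `τ`, then `σ`). -/
def comp {ι : Type v} (σ τ : FinTrans ι) : FinTrans ι :=
  ⟨σ.1 ∘ τ.1, by
    refine (σ.2.union τ.2).subset ?_
    intro i hi
    by_contra h
    simp only [Set.mem_union, Set.mem_ofPred_eq, not_or, not_not] at h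
    apply hi
    simp [h.1, h.2]⟩

/-- The replacement `[i|j]`: it sends `i` to `j` and fixes everything else. -/
def repl {ι : Type v} [DecidableEq ι] (i j : ι) : FinTrans ι :=
  ⟨Function.update id i j, by
    refine (Set.finite_singleton i).subset ?_
    intro k hk
    by_contra h
    exact hk (by simp [Function.update_of_ne (show k ≠ i from h)])⟩

/-- The transposition `[i,j]`. -/
def transp {ι : Type v} [DecidableEq ι] (i j : ι) : FinTrans ι :=
  ⟨Equiv.swap i j, by
    refine (Set.toFinite {i, j}).subset ?_
    intro k hk
    by_contra h
    simp only [Set.mem_insert_iff, Set.mem_singleton_iff, not_or] at h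
    exact hk (Equiv.swap_apply_of_ne_of_ne h.1 h.2)⟩

/-- A transformation of `n`, extended by the identity to a finite transformation of `ω`. -/
def extend {n : ℕ} (τ : FinTrans (Fin n)) : FinTrans ℕ :=
  ⟨fun i => if h : i < n then (τ.1 ⟨i, h⟩ : ℕ) else i, by
    refine (Set.finite_lt_nat n).subset ?_
    intro i hi
    by_contra h
    exact hi (dif_neg h)⟩

end FinTrans

/-- Algebras of the similarity type of quasi-polyadic equality algebras with index set `ι`:
a Boolean algebra with cylindrifiers `c i`, diagonal elements `d i j`, and a substitution
operation `s τ` for each finite transformation `τ`. -/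
structure PolyAlg (ι : Type v) where
  carrier : Type u
  [ba : BooleanAlgebra carrier]
  c : ι → carrier → carrier
  d : ι → ι → carrier
  s : FinTrans ι → carrier → carrier

attribute [instance] PolyAlg.ba

namespace PolyAlg

/-- The quasi-polyadic equality axioms. For `ι = Fin n` every transformation is finite and the
models are the polyadic equality algebras of dimension `n`; for `ι = ℕ` they are the algebras in
`QEA_ω`. The axioms relating substitutions and cylindrifiers are given for single cylindrifiers;
those for finite sets of indices follow by composition. -/
structure IsQPEA {ι : Type v} [DecidableEq ι] (A : PolyAlg.{u} ι) : Prop where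
  c_bot : ∀ i, A.c i ⊥ = ⊥
  le_c : ∀ i x, x ≤ A.c i x
  c_inf : ∀ i x y, A.c i (x ⊓ A.c i y) = A.c i x ⊓ A.c i y
  c_comm : ∀ i j x, A.c i (A.c j x) = A.c j (A.c i x)
  s_compl : ∀ τ x, A.s τ xᶜ = (A.s τ x)ᶜ
  s_sup : ∀ τ x y, A.s τ (x ⊔ y) = A.s τ x ⊔ A.s τ y
  s_one : ∀ x, A.s (FinTrans.one ι) x = x
  s_comp : ∀ σ τ x, A.s σ (A.s τ x) = A.s (σ.comp τ) x
  s_c : ∀ (σ τ : FinTrans ι) i, (∀ j, j ≠ i → σ.1 j = τ.1 j) →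
    ∀ x, A.s σ (A.c i x) = A.s τ (A.c i x)
  c_s : ∀ (τ : FinTrans ι) i j, (∀ k, τ.1 k = i ↔ k = j) →
    ∀ x, A.c i (A.s τ x) = A.s τ (A.c j x)
  c_s_of_notMem : ∀ (τ : FinTrans ι) i, (∀ k, τ.1 k ≠ i) →
    ∀ x, A.c i (A.s τ x) = A.s τ x
  d_self : ∀ i, A.d i i = ⊤
  s_d : ∀ (τ : FinTrans ι) i j, A.s τ (A.d i j) = A.d (τ.1 i) (τ.1 j)
  inf_d_le : ∀ i j x, x ⊓ A.d i j ≤ A.s (FinTrans.repl i j) x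

/-- Every element has a finite dimension set `{i : c i x ≠ x}`. -/
def LocallyFinite {ι : Type v} (A : PolyAlg.{u} ι) : Prop :=
  ∀ x : A.carrier, {i | A.c i x ≠ x}.Finite

/-- Every set of elements has a supremum. -/
def Complete {ι : Type v} (A : PolyAlg.{u} ι) : Prop :=
  ∀ S : Set A.carrier, ∃ x, IsLUB S x

/-- Isomorphism of algebras. -/
def Iso {ι : Type v} (A B : PolyAlg.{u} ι) : Prop :=
  ∃ e : A.carrier ≃o B.carrier,
    (∀ i x, e (A.c i x) = B.c i (e x)) ∧
    (∀ i j, e (A.d i j) = B.d i j) ∧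
    (∀ τ x, e (A.s τ x) = B.s τ (e x))

section NeatReduct

variable {ι : Type v} [DecidableEq ι] {A : PolyAlg.{u} ι}

theorem IsQPEA.c_idem (h : A.IsQPEA) (i : ι) (x : A.carrier) : A.c i (A.c i x) = A.c i x := by
  have h1 : A.c i ⊤ = ⊤ := top_le_iff.1 (h.le_c i ⊤)
  have h2 := h.c_inf i ⊤ x
  simpa [h1] using h2

theorem IsQPEA.c_mono (h : A.IsQPEA) (i : ι) {x y : A.carrier} (hxy : x ≤ y) :
    A.c i x ≤ A.c i y := by
  have h2 := h.c_inf i x y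
  rw [inf_eq_left.2 (hxy.trans (h.le_c i y))] at h2
  exact inf_eq_left.1 h2.symm

theorem IsQPEA.c_compl_of_fix (h : A.IsQPEA) {i : ι} {x : A.carrier} (hx : A.c i x = x) :
    A.c i xᶜ = xᶜ := by
  refine le_antisymm ?_ (h.le_c i _)
  have h2 := h.c_inf i xᶜ x
  rw [hx, compl_inf_eq_bot, h.c_bot] at h2
  exact le_compl_iff_disjoint_right.2 (disjoint_iff.2 h2.symm)

theorem IsQPEA.c_inf_of_fix (h : A.IsQPEA) {i : ι} {x y : A.carrier} (hx : A.c i x = x)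
    (hy : A.c i y = y) : A.c i (x ⊓ y) = x ⊓ y := by
  have h2 := h.c_inf i x y
  rwa [hy, hx] at h2

theorem IsQPEA.c_sup_of_fix (h : A.IsQPEA) {i : ι} {x y : A.carrier} (hx : A.c i x = x)
    (hy : A.c i y = y) : A.c i (x ⊔ y) = x ⊔ y := by
  have h2 := h.c_compl_of_fix
    (h.c_inf_of_fix (h.c_compl_of_fix hx) (h.c_compl_of_fix hy))
  simpa [compl_inf] using h2

theorem IsQPEA.c_d (h : A.IsQPEA) {i j k : ι} (hi : k ≠ i) (hj : k ≠ j) :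
    A.c k (A.d i j) = A.d i j := by
  have h1 := h.s_d (FinTrans.repl k i) i j
  simp only [FinTrans.repl, Function.update_of_ne hi.symm, Function.update_of_ne hj.symm,
    id] at h1
  have h2 := h.c_s_of_notMem (FinTrans.repl k i) k (by
    intro l hl
    by_cases hlk : l = k
    · subst hlk
      simp only [FinTrans.repl, Function.update_self] at hl
      exact hi hl.symm
    · simp only [FinTrans.repl, Function.update_of_ne hlk, id] at hl
      exact hlk hl) (A.d i j)
  simp only [FinTrans.repl] at h2
  rwa [h1] at h2

/-- The Boolean subalgebra of the elements whose dimension set is contained in `n`. -/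
def neatSub (D : PolyAlg.{u} ℕ) (hD : D.IsQPEA) (n : ℕ) : BooleanSubalgebra D.carrier where
  carrier := {x | ∀ i, n ≤ i → D.c i x = x}
  supClosed' := fun _ hx _ hy i hi => hD.c_sup_of_fix (hx i hi) (hy i hi)
  infClosed' := fun _ hx _ hy i hi => hD.c_inf_of_fix (hx i hi) (hy i hi)
  compl_mem' := fun hx i hi => hD.c_compl_of_fix (hx i hi)
  bot_mem' := fun i _ => hD.c_bot i

/-- The neat `n`-reduct of an algebra in `QEA_ω`. -/
abbrev neatReduct (D : PolyAlg.{u} ℕ) (hD : D.IsQPEA) (n : ℕ) : PolyAlg.{u} (Fin n) where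
  carrier := D.neatSub hD n
  c := fun i x => ⟨D.c i x.1, fun k hk => by rw [hD.c_comm, x.2 k hk]⟩
  d := fun i j => ⟨D.d i j, fun k hk =>
    hD.c_d (by have := i.2; omega) (by have := j.2; omega)⟩
  s := fun τ x => ⟨D.s τ.extend x.1, fun k hk => by
    rw [hD.c_s τ.extend k k ?_, x.2 k hk]
    intro l
    by_cases hl : l < n
    · have h1 := (τ.1 ⟨l, hl⟩).2
      simp only [FinTrans.extend, dif_pos hl]
      omega
    · simp only [FinTrans.extend, dif_neg hl]⟩

end NeatReduct

end PolyAlg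

/-! ### Atom structures -/

/-- Relational structures of the type of atom structures of polyadic equality algebras:
`cyl i`, `sub τ` are the accessibility relations of `c i`, `s τ`, and `diag i j` is the set of
atoms below `d i j`. -/
structure PolyAtomStr (ι : Type v) where
  carrier : Type u
  cyl : ι → carrier → carrier → Prop
  diag : ι → ι → carrier → Prop
  sub : FinTrans ι → carrier → carrier → Prop

/-- The atom structure `At A`. -/
abbrev PolyAlg.atomStr {ι : Type v} (A : PolyAlg.{u} ι) : PolyAtomStr.{u} ι where
  carrier := {a : A.carrier // IsAtom a}
  cyl := fun i a b => a.1 ≤ A.c i b.1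
  diag := fun i j a => a.1 ≤ A.d i j
  sub := fun τ a b => a.1 ≤ A.s τ b.1

namespace PolyAtomStr

/-- Isomorphism of atom structures. -/
def Iso {ι : Type v} (α β : PolyAtomStr.{u} ι) : Prop :=
  ∃ e : α.carrier ≃ β.carrier,
    (∀ i a b, α.cyl i a b ↔ β.cyl i (e a) (e b)) ∧
    (∀ i j a, α.diag i j a ↔ β.diag i j (e a)) ∧
    (∀ τ a b, α.sub τ a b ↔ β.sub τ (e a) (e b))

/-- The complex algebra `Cm α`: the power set of `α` with the operations induced by the
accessibility relations. -/
abbrev complexAlg {ι : Type v} (α : PolyAtomStr.{u} ι) : PolyAlg.{u} ι where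
  carrier := Set α.carrier
  c := fun i S => {a | ∃ b ∈ S, α.cyl i a b}
  d := fun i j => {a | α.diag i j a}
  s := fun τ S => {a | ∃ b ∈ S, α.sub τ a b}

/-- `α` is a `PEA_n` atom structure: it is (up to isomorphism) the atom structure of an atomic
polyadic equality algebra of dimension `n`. -/
def IsPEAAtomStr {n : ℕ} (α : PolyAtomStr.{u} (Fin n)) : Prop :=
  ∃ A : PolyAlg.{u} (Fin n), A.IsQPEA ∧ IsAtomic A.carrier ∧ α.Iso A.atomStr

end PolyAtomStr

/-! ### Two-player games with `ω` rounds -/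

/-- A game with `ω` rounds between `∀` and `∃`. In each round `∀` moves first and `∃` responds.
A history lists the completed rounds, the earliest first. `∃` wins a play if she makes a legal
response in each of the `ω` rounds. -/
structure OmegaGame : Type (max (u + 1) (v + 1)) where
  MoveA : Type u
  MoveE : Type v
  legalA : List (MoveA × MoveE) → MoveA → Prop
  legalE : List (MoveA × MoveE) → MoveA → MoveE → Prop

namespace OmegaGame

/-- The first `r` rounds of the play in which `∀` plays the moves `m 0, m 1, …` and `∃` follows
the strategy `σ`. -/
def history (G : OmegaGame.{u, v}) (σ : List (G.MoveA × G.MoveE) → G.MoveA → G.MoveE)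
    (m : ℕ → G.MoveA) : ℕ → List (G.MoveA × G.MoveE)
  | 0 => []
  | r + 1 => G.history σ m r ++ [(m r, σ (G.history σ m r) (m r))]

/-- `∃` has a winning strategy: one by which she always has a legal response, as long as `∀`
has made only legal moves. -/
def ExistsWins (G : OmegaGame.{u, v}) : Prop :=
  ∃ σ : List (G.MoveA × G.MoveE) → G.MoveA → G.MoveE, ∀ (m : ℕ → G.MoveA) (r : ℕ),
    (∀ t ≤ r, G.legalA (G.history σ m t) (m t)) →
      G.legalE (G.history σ m r) (m r) (σ (G.history σ m r) (m r))

end OmegaGame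

/-! ### Hypernetworks -/

/-- A labelling of the `n`-tuples (by elements of `X`) and of the finite sequences (by elements
of `Λ`) of a finite set of nodes in `ω`. The two functions are total for convenience; only their
values on tuples and sequences of nodes are ever used. -/
structure HyperNet (n : ℕ) (X : Type u) (Λ : Type w) where
  nodes : Finset ℕ
  label : (Fin n → ℕ) → X
  hyper : List ℕ → Λ

namespace HyperNet

variable {n : ℕ} {Λ : Type w}

/-- `x` is an `n`-tuple of nodes. -/
def IsTuple {X : Type u} (N : HyperNet n X Λ) (x : Fin n → ℕ) : Prop := ∀ i, x i ∈ N.nodes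

/-- `xs` is a finite sequence of nodes. -/
def IsSeq {X : Type u} (N : HyperNet n X Λ) (xs : List ℕ) : Prop := ∀ x ∈ xs, x ∈ N.nodes

/-- `x ∼ y`: some tuple of nodes `(x, y, z₂, …)` is labelled by an atom below `d 0 1`. -/
def Sim {α : PolyAtomStr.{u} (Fin n)} (N : HyperNet n α.carrier Λ) (x y : ℕ) : Prop :=
  ∃ (z : Fin n → ℕ) (i j : Fin n), N.IsTuple z ∧ (i : ℕ) = 0 ∧ (j : ℕ) = 1 ∧
    z i = x ∧ z j = y ∧ α.diag i j (N.label z)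

/-- The labels of the `n`-tuples of nodes form an atomic network over `α`. -/
structure IsNetwork {α : PolyAtomStr.{u} (Fin n)} (N : HyperNet n α.carrier Λ) : Prop where
  nonempty : N.nodes.Nonempty
  diag : ∀ x, N.IsTuple x → ∀ i j, α.diag i j (N.label (Function.update x i (x j)))
  cyl : ∀ x, N.IsTuple x → ∀ i, ∀ e ∈ N.nodes,
    α.cyl i (N.label (Function.update x i e)) (N.label x)
  /-- The label of `x ∘ [i,j]` is the atom `s_[i,j] (N x)`. -/
  sub : ∀ x, N.IsTuple x → ∀ i j a,
    α.sub (FinTrans.transp i j) a (N.label x) ↔ a = N.label (x ∘ Equiv.swap i j)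

/-- A hypernetwork: both labellings respect `∼`. -/
structure IsHypernetwork {α : PolyAtomStr.{u} (Fin n)} (N : HyperNet n α.carrier Λ) :
    Prop where
  network : N.IsNetwork
  label_congr : ∀ x y, N.IsTuple x → N.IsTuple y → (∀ i, N.Sim (x i) (y i)) →
    N.label x = N.label y
  hyper_congr : ∀ xs ys, N.IsSeq xs → N.IsSeq ys → List.Forall₂ N.Sim xs ys →
    N.hyper xs = N.hyper ys

/-- A sequence of nodes is short if there are nodes `y₀, …, y_{n-1}` such that each of its
entries is `∼` to some `y_j`. Otherwise it is long. -/
def Short {α : PolyAtomStr.{u} (Fin n)} (N : HyperNet n α.carrier Λ) (xs : List ℕ) : Prop :=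
  ∃ y : Fin n → ℕ, N.IsTuple y ∧ ∀ x ∈ xs, ∃ j, N.Sim x (y j)

/-- A `lam`-neat hypernetwork: a hypernetwork all of whose short hyperedges are labelled
`lam`. -/
def IsNeat {α : PolyAtomStr.{u} (Fin n)} (lam : Λ) (N : HyperNet n α.carrier Λ) : Prop :=
  N.IsHypernetwork ∧ ∀ xs, N.IsSeq xs → N.Short xs → N.hyper xs = lam

/-- `M` and `N` agree on the set `S` of nodes, that is, `M ≡^S N` (used for `S` contained in
both sets of nodes). -/
def AgreeOn {X : Type u} (S : Finset ℕ) (M N : HyperNet n X Λ) : Prop :=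
  (∀ x : Fin n → ℕ, (∀ i, x i ∈ S) → M.label x = N.label x) ∧
  (∀ xs : List ℕ, (∀ x ∈ xs, x ∈ S) → M.hyper xs = N.hyper xs)

/-- `L` extends `N`. -/
def Extends {X : Type u} (L N : HyperNet n X Λ) : Prop :=
  N.nodes ⊆ L.nodes ∧ AgreeOn N.nodes L N

/-- `L` is the transform `N θ` of `N` by the partial map `θ` with domain `dom`, which is assumed
to map `dom` onto the nodes of `N`. -/
def IsTransform {X : Type u} (N : HyperNet n X Λ) (dom : Finset ℕ) (θ : ℕ → ℕ)
    (L : HyperNet n X Λ) : Prop :=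
  L.nodes = dom ∧
  (∀ x : Fin n → ℕ, (∀ i, x i ∈ dom) → L.label x = N.label (θ ∘ x)) ∧
  (∀ xs : List ℕ, (∀ x ∈ xs, x ∈ dom) → L.hyper xs = N.hyper (xs.map θ))

end HyperNet

/-! ### The game `J` -/

/-- The moves of `∀` in the game `J`. -/
inductive JMove (n : ℕ) (X : Type u) (Λ : Type w) : Type (max u w)
  /-- The opening move: an atom. -/
  | initial (a : X) : JMove n X Λ
  /-- A cylindrifier move: a hypernetwork `N`, a tuple `f` of nodes (whose `l`-th entry is
  immaterial), an index `l`, a new node `k` and an atom `b`. -/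
  | cylindrifier (N : HyperNet n X Λ) (f : Fin n → ℕ) (l : Fin n) (k : ℕ) (b : X) : JMove n X Λ
  /-- A transformation move: a hypernetwork `N` and a finite partial map on `ω`, given by its
  domain and its values. -/
  | transformation (N : HyperNet n X Λ) (dom : Finset ℕ) (θ : ℕ → ℕ) : JMove n X Λ
  /-- An amalgamation move: two hypernetworks. -/
  | amalgamation (M N : HyperNet n X Λ) : JMove n X Λ

namespace JMove

variable {n : ℕ} {Λ : Type w} {α : PolyAtomStr.{u} (Fin n)}

/-- The hypernetwork `N` was played in the history `h`. -/
def Played {X : Type u} (h : List (JMove n X Λ × HyperNet n X Λ)) (N : HyperNet n X Λ) : Prop :=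
  N ∈ h.map Prod.snd

/-- The legal moves of `∀`: he opens with an atom and makes one of the three other kinds of moves
in each later round. -/
def LegalA (h : List (JMove n α.carrier Λ × HyperNet n α.carrier Λ)) :
    JMove n α.carrier Λ → Prop
  | initial _ => h = []
  | cylindrifier N f l k b => Played h N ∧ N.IsTuple f ∧ k ∉ N.nodes ∧ α.cyl l b (N.label f)
  | transformation N dom θ => Played h N ∧ dom.image θ = N.nodes
  | amalgamation M N => Played h M ∧ Played h N ∧ (M.nodes ∩ N.nodes).Nonempty ∧
      HyperNet.AgreeOn (M.nodes ∩ N.nodes) M N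

/-- The legal responses of `∃`, which must be `lam`-neat hypernetworks. -/
def LegalE (lam : Λ) (m : JMove n α.carrier Λ) (L : HyperNet n α.carrier Λ) : Prop :=
  L.IsNeat lam ∧
  match m with
  | initial a => ∃ x, L.IsTuple x ∧ L.label x = a
  | cylindrifier N f l k b => L.Extends N ∧ L.nodes = insert k N.nodes ∧
      L.label (Function.update f l k) = b
  | transformation N dom θ => N.IsTransform dom θ L
  | amalgamation M N => L.Extends M ∧ L.Extends N ∧ L.nodes = M.nodes ∪ N.nodes

end JMove

/-- The game `J` on the atom structure `α`, with hyperlabels from `Λ` and the label `lam` for the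
short hyperedges. -/
abbrev gameJ {n : ℕ} (α : PolyAtomStr.{u} (Fin n)) (Λ : Type w) (lam : Λ) :
    OmegaGame.{max u w, max u w} where
  MoveA := JMove n α.carrier Λ
  MoveE := HyperNet n α.carrier Λ
  legalA := JMove.LegalA
  legalE := fun _ m L => JMove.LegalE lam m L

/-! The hypernetworks occurring in plays where `∃` follows her strategy can always be extended. A
cylindrifier move adds a witness for an admissible atom. A transformation move followed by an
amalgamation move extends a finite nonempty partial isomorphism by one more node
(`exists_isSaturating`). As there are countably many atoms, all such requests about a growing chain
can be scheduled; they never mention hyperlabels, so `Λ` may be arbitrary. The limit of the chain is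
a homogeneous model in which a prescribed atom occurs as a label
(`IsSaturating.exists_isHomogeneousModel`).

A homogeneous model realizes exactly the atoms of one class of the equivalence generated by the
cylindrifier relations. With one model per class, each atom is realized in exactly one model. The
locally finite algebra consists of the sets of assignments of `ω` into these models for which
membership is decided by the isomorphism type of finitely many coordinates, with `d i j` interpreted
by `∼`. Homogeneity closes it under cylindrification and shows that an element of the neat reduct is
supported on the first `n` coordinates. Since every sequence through an `n`-tuple is short and hence
labelled `lam`, tuples with equal labels are partially isomorphic. So the elements of the neat
reduct are the preimages of sets of atoms, a copy of the complex algebra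
(`complexAlg_iso_neatReduct_modelAlg`).

For the second claim the algebra is completed. All operators are residuated, so the axioms pass to
the Boolean completion (`IsQPEA.completion`). The neat reduct gains no elements, because it is
already complete and local finiteness lets every element be approximated from both sides inside it
(`IsQPEA.exists_complete`). -/

/-! ### The completion of a Boolean algebra -/

/-- Every Boolean algebra is a sup-dense Boolean subalgebra of a complete Boolean algebra. -/
theorem exists_completion (A : Type u) [BooleanAlgebra A] :
    ∃ (B : Type u) (_ : CompleteBooleanAlgebra B) (e : A ↪o B),
      (∀ a b, e (a ⊓ b) = e a ⊓ e b) ∧ (∀ a, e aᶜ = (e a)ᶜ) ∧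
      ∀ x, IsLUB {y | ∃ a, e a ≤ x ∧ e a = y} x := by
  -- The completion is the algebra of regular elements of the frame of lower sets of `P`. Without
  -- `⊥`, the pseudocomplement of `lo a` is `lo aᶜ`: a nonzero `p ⊓ a` is itself a point below `p`.
  let P := {a : A // a ≠ ⊥}
  let H := LowerSet P
  have mem_compl (I : H) (p : P) : p ∈ Iᶜ ↔ ∀ q ≤ p, q ∉ I := by
    constructor
    · intro hp q hq hqI
      have h1 : LowerSet.Iic q ≤ I ⊓ Iᶜ := by
        refine le_inf ?_ ?_
        · exact LowerSet.Iic_le.2 hqI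
        · exact LowerSet.Iic_le.2 (Iᶜ.lower hq hp)
      rw [inf_compl_eq_bot] at h1
      exact (LowerSet.Iic_le.1 h1)
    · intro h
      have h1 : LowerSet.Iic p ≤ Iᶜ := by
        rw [le_compl_iff_disjoint_right, disjoint_iff_inf_le]
        rintro q ⟨hq1, hq2⟩
        exact (h q hq1 hq2).elim
      exact LowerSet.Iic_le.1 h1
  let lo (a : A) : H := ⟨{p | p.1 ≤ a}, fun p q hqp hp => le_trans hqp hp⟩
  have lo_compl (a : A) : lo aᶜ = (lo a)ᶜ := by
    ext p
    show p.1 ≤ aᶜ ↔ p ∈ (lo a)ᶜ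
    rw [mem_compl]
    constructor
    · intro hp q hq hqa
      exact q.2 (le_bot_iff.1 ((le_inf hqa (le_trans hq hp)).trans_eq inf_compl_eq_bot))
    · intro h
      rw [le_compl_iff_disjoint_right, disjoint_iff]
      by_contra hne
      exact h ⟨p.1 ⊓ a, hne⟩ inf_le_left inf_le_right
  have reg (a : A) : Heyting.IsRegular (lo a) := by
    show (lo a)ᶜᶜ = lo a
    rw [← lo_compl, ← lo_compl, compl_compl]
  let inst : CompleteBooleanAlgebra (Heyting.Regular H) :=
    { (inferInstance : BooleanAlgebra (Heyting.Regular H)),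
      (Heyting.Regular.gi (α := H)).liftCompleteLattice with }
  have hle (a b : A) : lo a ≤ lo b ↔ a ≤ b := by
    constructor
    · intro h
      by_cases ha : a = ⊥
      · simp [ha]
      · exact h (show (⟨a, ha⟩ : P) ∈ lo a from le_rfl)
    · intro h p hp
      exact le_trans hp h
  let e : A ↪o Heyting.Regular H := OrderEmbedding.ofMapLEIff (fun a => ⟨lo a, reg a⟩) hle
  refine ⟨Heyting.Regular H, inst, e, ?_, ?_, ?_⟩
  · intro a b
    apply Heyting.Regular.coe_injective
    ext p
    exact le_inf_iff
  · intro a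
    apply Heyting.Regular.coe_injective
    exact lo_compl a
  · intro x
    constructor
    · rintro _ ⟨a, ha, rfl⟩
      exact ha
    · intro z hz p hp
      have h1 : e p.1 ≤ x := fun q hq => x.val.lower (show q ≤ p from hq) hp
      exact hz ⟨p.1, h1, rfl⟩ (show p ∈ lo p.1 from le_rfl)

/-! ### Finite transformations -/

namespace FinTrans

/-- The finite transformations are generated by replacements and transpositions. -/
theorem induction {ι : Type v} [DecidableEq ι] {P : FinTrans ι → Prop}
    (one : P (FinTrans.one ι)) (comp : ∀ σ τ, P σ → P τ → P (σ.comp τ))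
    (repl : ∀ i j, i ≠ j → P (FinTrans.repl i j)) (transp : ∀ i j, P (FinTrans.transp i j))
    (τ : FinTrans ι) : P τ := by
  induction hm : {i | τ.1 i ≠ i}.ncard using Nat.strong_induction_on generalizing τ with
  | _ m ih =>
  subst hm
  -- A map that fixes `i` and every fixed point of `τ` moves fewer points, so the induction
  -- hypothesis covers it.
  have key (τ' : ι → ι) (i : ι) (hi : τ.1 i ≠ i) (h : ∀ k, k = i ∨ τ.1 k = k → τ' k = k) :
      ∃ τ'' : FinTrans ι, τ''.1 = τ' ∧ P τ'' := by
    have hsub : {k | τ' k ≠ k} ⊆ {k | τ.1 k ≠ k} \ {i} := by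
      intro k hk
      refine ⟨fun h1 => hk (h k (Or.inr h1)), fun h1 => hk (h k (Or.inl h1))⟩
    have hfin := τ.2.subset (hsub.trans Set.sdiff_subset)
    refine ⟨⟨τ', hfin⟩, rfl, ih _ ?_ _ rfl⟩
    exact (Set.ncard_le_ncard hsub (τ.2.subset Set.sdiff_subset)).trans_lt
      (Set.ncard_sdiff_singleton_lt_of_mem hi τ.2)
  by_cases h0 : ∀ i, τ.1 i = i
  · have : τ = FinTrans.one ι := Subtype.ext (funext h0)
    rwa [this]
  -- A moved point outside the range can first be made fixed; a final replacement then sends it to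
  -- its value and disturbs nothing else.
  by_cases h1 : ∃ i, τ.1 i ≠ i ∧ ∀ k, τ.1 k ≠ i
  · obtain ⟨i, hi, hk⟩ := h1
    obtain ⟨τ', h2, h3⟩ := key (Function.update τ.1 i i) i hi (by
      intro k hk
      by_cases hki : k = i
      · subst hki; simp
      · rw [Function.update_of_ne hki]
        exact hk.resolve_left hki)
    have : τ = (FinTrans.repl i (τ.1 i)).comp τ' := by
      apply Subtype.ext
      funext k
      show τ.1 k = Function.update id i (τ.1 i) (τ'.1 k)
      rw [h2]
      by_cases hki : k = i
      · subst hki; simp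
      · rw [Function.update_of_ne hki, Function.update_of_ne (hk k), id]
    rw [this]
    exact comp _ _ (repl _ _ hi.symm) h3
  · push Not at h0 h1
    obtain ⟨i, hi⟩ := h0
    -- All moved points are values, so by counting `τ` maps the moved set onto itself. Thus `τ i` is
    -- moved as well, and a transposition applied after `τ` fixes `i` without moving a fixed point.
    have hsub : {i | τ.1 i ≠ i} ⊆ τ.1 '' {i | τ.1 i ≠ i} := by
      intro j hj
      obtain ⟨k, hk⟩ := h1 j hj
      refine ⟨k, fun h => hj ?_, hk⟩
      rw [← hk, h, h]
    have heq := Set.eq_of_subset_of_ncard_le hsub (Set.ncard_image_le τ.2) (τ.2.image _)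
    have hinj : Set.InjOn τ.1 {i | τ.1 i ≠ i} :=
      Set.injOn_of_ncard_image_eq (by rw [← heq]) τ.2
    have hj : τ.1 (τ.1 i) ≠ τ.1 i := by
      have : τ.1 i ∈ {i | τ.1 i ≠ i} := by
        rw [heq]; exact ⟨i, hi, rfl⟩
      exact this
    obtain ⟨τ', h2, h3⟩ := key (Equiv.swap i (τ.1 i) ∘ τ.1) i hi (by
      rintro k (rfl | hk)
      · simp
      · have hki : k ≠ i := by rintro rfl; exact hi hk
        have hkj : k ≠ τ.1 i := by rintro rfl; exact hj hk
        simp [hk, Equiv.swap_apply_of_ne_of_ne hki hkj])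
    have : τ = (FinTrans.transp i (τ.1 i)).comp τ' := by
      apply Subtype.ext
      funext k
      show τ.1 k = Equiv.swap i (τ.1 i) (τ'.1 k)
      rw [h2]
      simp
    rw [this]
    exact comp _ _ (transp _ _) h3

theorem repl_apply {ι : Type v} [DecidableEq ι] (i j k : ι) :
    (FinTrans.repl i j).1 k = if k = i then j else k := by
  simp [FinTrans.repl, Function.update_apply]

theorem transp_comp_self {ι : Type v} [DecidableEq ι] (i j : ι) :
    (transp i j).comp (transp i j) = one ι := by
  apply Subtype.ext
  funext k
  exact Equiv.swap_apply_self i j k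

theorem repl_ne {ι : Type v} [DecidableEq ι] {i j : ι} (h : i ≠ j) (k : ι) :
    (repl i j).1 k ≠ i := by
  rw [repl_apply]
  split_ifs with hk
  exacts [h.symm, hk]

end FinTrans

/-! ### Substitutions and cylindrifiers as residuated maps. -/

namespace PolyAlg.IsQPEA

variable {ι : Type v} [DecidableEq ι] {A : PolyAlg.{u} ι}

theorem s_mono (h : A.IsQPEA) (τ : FinTrans ι) : Monotone (A.s τ) := by
  intro x y hxy
  have := h.s_sup τ x y
  rw [sup_eq_right.2 hxy] at this
  exact sup_eq_left.1 (by rw [sup_comm]; exact this.symm)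

theorem s_inf (h : A.IsQPEA) (τ : FinTrans ι) (x y : A.carrier) :
    A.s τ (x ⊓ y) = A.s τ x ⊓ A.s τ y := by
  have := h.s_compl τ (xᶜ ⊔ yᶜ)
  rwa [compl_sup, compl_compl, compl_compl, h.s_sup, h.s_compl, h.s_compl, compl_sup, compl_compl,
    compl_compl] at this

theorem s_bot (h : A.IsQPEA) (τ : FinTrans ι) : A.s τ ⊥ = ⊥ := by
  have := h.s_inf τ ⊥ ⊥ᶜ
  rwa [inf_compl_eq_bot, h.s_compl, inf_compl_eq_bot] at this

theorem s_top (h : A.IsQPEA) (τ : FinTrans ι) : A.s τ ⊤ = ⊤ := by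
  rw [← compl_bot, h.s_compl, h.s_bot, compl_bot]

/-- Cylindrifiers are self-conjugate. -/
theorem disjoint_c (h : A.IsQPEA) {i : ι} {x y : A.carrier} (hxy : Disjoint x (A.c i y)) :
    Disjoint (A.c i x) y := by
  have h2 := h.c_inf i x y
  rw [hxy.eq_bot, h.c_bot] at h2
  exact (disjoint_iff.2 h2.symm).mono_right (h.le_c i y)

theorem c_gc (h : A.IsQPEA) (i : ι) : GaloisConnection (A.c i) (fun z => (A.c i zᶜ)ᶜ) := by
  intro x z
  rw [le_compl_iff_disjoint_right, ← disjoint_compl_right_iff]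
  exact ⟨fun hd => (h.disjoint_c hd.symm).symm, h.disjoint_c⟩

/-- The right side is below the left because `s (repl i j) x` is closed under `c i`. Conversely, the
right sides for `x` and `xᶜ` cover `⊤`, and the one for `xᶜ` is disjoint from the left side. -/
theorem s_repl (h : A.IsQPEA) {i j : ι} (hij : i ≠ j) (x : A.carrier) :
    A.s (FinTrans.repl i j) x = A.c i (A.d i j ⊓ x) := by
  have hle (x : A.carrier) : A.c i (A.d i j ⊓ x) ≤ A.s (FinTrans.repl i j) x := by
    rw [← h.c_s_of_notMem (FinTrans.repl i j) i (FinTrans.repl_ne hij) x, inf_comm]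
    exact h.c_mono i (h.inf_d_le i j x)
  refine le_antisymm ?_ (hle x)
  -- The replacement acts as the identity on `c i (d i j)` and sends the smaller `d i j` to `d j j =
  -- ⊤`.
  have hd : A.c i (A.d i j) = ⊤ := by
    have h1 := h.s_d (FinTrans.repl i j) i j
    have h2 := h.s_c (FinTrans.repl i j) (FinTrans.one ι) i (by
      intro k hk
      rw [FinTrans.repl_apply, if_neg hk]; rfl) (A.d i j)
    have h3 := h.s_mono (FinTrans.repl i j) (h.le_c i (A.d i j))
    rw [h2, h.s_one, h1, FinTrans.repl_apply, FinTrans.repl_apply, if_pos rfl,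
      if_neg hij.symm, h.d_self] at h3
    exact top_le_iff.1 h3
  have h1 : A.s (FinTrans.repl i j) x ≤ A.c i (A.d i j ⊓ x) ⊔ A.c i (A.d i j ⊓ xᶜ) := by
    rw [← (h.c_gc i).l_sup, ← inf_sup_left, sup_compl_eq_top, inf_top_eq, hd]
    exact le_top
  have h2 : Disjoint (A.s (FinTrans.repl i j) x) (A.c i (A.d i j ⊓ xᶜ)) := by
    refine Disjoint.mono_right (hle xᶜ) ?_
    rw [h.s_compl]
    exact disjoint_compl_right
  exact Disjoint.left_le_of_le_sup_right h1 h2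

/-- The operations `s τ` are completely additive. -/
theorem s_gc (h : A.IsQPEA) (τ : FinTrans ι) : ∃ g, GaloisConnection (A.s τ) g := by
  induction τ using FinTrans.induction with
  | one =>
    refine ⟨id, fun x y => ?_⟩
    rw [h.s_one, id]
  | comp σ τ hσ hτ =>
    obtain ⟨g, hg⟩ := hσ
    obtain ⟨k, hk⟩ := hτ
    refine ⟨k ∘ g, fun x y => ?_⟩
    rw [← h.s_comp]
    exact (hk.compose hg) x y
  | repl i j hij =>
    refine ⟨fun z => A.d i j ⇨ (A.c i zᶜ)ᶜ, fun x z => ?_⟩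
    rw [h.s_repl hij, h.c_gc i, le_himp_iff, inf_comm]
  | transp i j =>
    have hs (x : A.carrier) : A.s (FinTrans.transp i j) (A.s (FinTrans.transp i j) x) = x := by
      rw [h.s_comp, FinTrans.transp_comp_self, h.s_one]
    refine ⟨A.s (FinTrans.transp i j), fun x z => ⟨fun hx => ?_, fun hx => ?_⟩⟩
    · simpa [hs] using h.s_mono (FinTrans.transp i j) hx
    · simpa [hs] using h.s_mono (FinTrans.transp i j) hx

end PolyAlg.IsQPEA

/-! ### Completions of quasi-polyadic equality algebras -/

/-- `e` embeds `A` as a sup-dense Boolean subalgebra of the complete Boolean algebra `B`. -/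
structure IsBoolCompletion {A B : Type u} [BooleanAlgebra A] [CompleteBooleanAlgebra B]
    (e : A ↪o B) : Prop where
  map_inf : ∀ a b, e (a ⊓ b) = e a ⊓ e b
  map_compl : ∀ a, e aᶜ = (e a)ᶜ
  dense : ∀ x, IsLUB {y | ∃ a, e a ≤ x ∧ e a = y} x

/-- The completely additive extension of an operation to the completion. -/
def completionMap {A B : Type u} [BooleanAlgebra A] [CompleteBooleanAlgebra B]
    (e : A ↪o B) (f : A → A) (x : B) : B := ⨆ a : {a // e a ≤ x}, e (f a)

namespace IsBoolCompletion

variable {A B : Type u} [BooleanAlgebra A] [CompleteBooleanAlgebra B] {e : A ↪o B}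

theorem map_bot (he : IsBoolCompletion e) : e ⊥ = ⊥ := by
  rw [← inf_compl_eq_bot (a := (⊥ : A)), he.map_inf, he.map_compl, inf_compl_eq_bot]

theorem map_top (he : IsBoolCompletion e) : e ⊤ = ⊤ := by
  rw [← compl_bot, he.map_compl, he.map_bot, compl_bot]

theorem le_of_forall (he : IsBoolCompletion e) {x y : B} (h : ∀ a, e a ≤ x → e a ≤ y) :
    x ≤ y := by
  refine (he.dense x).2 ?_
  rintro _ ⟨a, ha, rfl⟩
  exact h a ha

/-- Complementation turns sup-density into inf-density. -/
theorem le_of_forall_ge (he : IsBoolCompletion e) {x y : B} (h : ∀ a, y ≤ e a → x ≤ e a) :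
    x ≤ y := by
  rw [← compl_le_compl_iff_le]
  refine he.le_of_forall fun a ha => ?_
  rw [le_compl_comm, ← he.map_compl] at ha ⊢
  exact h _ ha

theorem eq_iSup (he : IsBoolCompletion e) (x : B) : x = ⨆ a : {a // e a ≤ x}, e a :=
  le_antisymm (he.le_of_forall fun a ha => le_iSup (fun a : {a // e a ≤ x} => e a.1) ⟨a, ha⟩)
    (iSup_le fun a => a.2)

theorem completionMap_le {f : A → A} {x z : B} :
    completionMap e f x ≤ z ↔ ∀ a, e a ≤ x → e (f a) ≤ z := by
  simp [completionMap, iSup_le_iff]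

theorem le_completionMap {f : A → A} {x : B} {a : A} (ha : e a ≤ x) :
    e (f a) ≤ completionMap e f x :=
  completionMap_le.1 le_rfl a ha

theorem completionMap_mono (f : A → A) : Monotone (completionMap e f) := fun _ _ hxy =>
  completionMap_le.2 fun _ ha => le_completionMap (ha.trans hxy)

theorem completionMap_apply {f : A → A} (hf : Monotone f) (a : A) :
    completionMap e f (e a) = e (f a) :=
  le_antisymm (completionMap_le.2 fun _ hb => e.monotone (hf (e.le_iff_le.1 hb)))
    (le_completionMap le_rfl)

/-- By inf-density it suffices to test `z` against elements `w` of `A` above it. There the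
adjunction in `A` bounds the supremum on the right by `e (g w)`. -/
theorem completionMap_gc (he : IsBoolCompletion e) {f g : A → A} (hfg : GaloisConnection f g) :
    GaloisConnection (completionMap e f) (fun z => ⨆ a : {a // e (f a) ≤ z}, e a) := by
  intro x z
  rw [completionMap_le]
  constructor
  · exact fun h => he.le_of_forall fun a ha =>
      le_iSup (fun a : {a // e (f a) ≤ z} => e a.1) ⟨a, h a ha⟩
  · intro h a ha
    refine he.le_of_forall_ge fun w hw => e.monotone (hfg.l_le (e.le_iff_le.1 (ha.trans (h.trans ?_))))
    exact iSup_le fun b => e.monotone (hfg.le_u (e.le_iff_le.1 (b.2.trans hw)))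

/-- The extension of a residuated `f` preserves suprema, so it may be applied termwise to the
supremum defining the inner extension. This is how identities between composites of operators pass
to the completion. -/
theorem completionMap_comp (he : IsBoolCompletion e) {f f' g : A → A}
    (hf : GaloisConnection f f') (x : B) :
    completionMap e f (completionMap e g x) = completionMap e (f ∘ g) x := by
  rw [completionMap.eq_1 e g, (he.completionMap_gc hf).l_iSup]
  simp only [completionMap_apply hf.monotone_l]
  rfl

end IsBoolCompletion

namespace PolyAlg

variable {ι : Type v} [DecidableEq ι] {A : PolyAlg.{u} ι}

/-- The completion of an algebra. -/
abbrev completion {B : Type u} [CompleteBooleanAlgebra B] (A : PolyAlg.{u} ι) (e : A.carrier ↪o B) :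
    PolyAlg.{u} ι where
  carrier := B
  c i := completionMap e (A.c i)
  d i j := e (A.d i j)
  s τ := completionMap e (A.s τ)

-- Composite identities follow from `completionMap_comp`, the others by distributing over suprema.
-- Complements are not monotone, so `s_compl` is obtained by checking separately that the two images
-- are disjoint and that they cover `⊤`.
open IsBoolCompletion in
theorem IsQPEA.completion {B : Type u} [CompleteBooleanAlgebra B] (h : A.IsQPEA)
    {e : A.carrier ↪o B} (he : IsBoolCompletion e) : (A.completion e).IsQPEA := by
  have cc (i : ι) (g : A.carrier → A.carrier) (x : B) := he.completionMap_comp (g := g) (h.c_gc i) x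
  have ss (τ : FinTrans ι) (g : A.carrier → A.carrier) (x : B) :
      completionMap e (A.s τ) (completionMap e g x) = completionMap e (A.s τ ∘ g) x :=
    he.completionMap_comp (h.s_gc τ).choose_spec x
  have sup (τ : FinTrans ι) (x y : B) : completionMap e (A.s τ) (x ⊔ y) =
      completionMap e (A.s τ) x ⊔ completionMap e (A.s τ) y :=
    (he.completionMap_gc (h.s_gc τ).choose_spec).l_sup
  have inf {f g : A.carrier → A.carrier} {x y z : B}
      (hz : ∀ a b, e a ≤ x → e b ≤ y → e (f a ⊓ g b) ≤ z) :
      completionMap e f x ⊓ completionMap e g y ≤ z := by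
    rw [completionMap, completionMap, iSup_inf_iSup, iSup_le_iff]
    rintro ⟨a, b⟩
    rw [← he.map_inf]
    exact hz _ _ a.2 b.2
  have le_c (i : ι) (x : B) : x ≤ completionMap e (A.c i) x :=
    he.le_of_forall fun a ha => (e.monotone (h.le_c i a)).trans (le_completionMap ha)
  have c_idem (i : ι) (x : B) :
      completionMap e (A.c i) (completionMap e (A.c i) x) = completionMap e (A.c i) x := by
    rw [cc]
    exact congrArg (completionMap e · x) (funext fun a => h.c_idem i a)
  constructor
  · intro i
    refine le_bot_iff.1 (completionMap_le.2 fun a (ha : e a ≤ (⊥ : B)) => ?_)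
    rw [← he.map_bot, e.le_iff_le, le_bot_iff] at ha
    rw [ha, h.c_bot, he.map_bot]
  · exact le_c
  · intro i (x : B) (y : B)
    refine le_antisymm (le_inf (completionMap_mono _ inf_le_left) ?_) (inf fun a b ha hb => ?_)
    · exact (completionMap_mono _ inf_le_right).trans (c_idem i y).le
    · rw [← h.c_inf]
      refine le_completionMap ?_
      rw [he.map_inf]
      exact inf_le_inf ha (le_completionMap hb)
  · intro i j (x : B)
    show completionMap e (A.c i) (completionMap e (A.c j) x) =
      completionMap e (A.c j) (completionMap e (A.c i) x)
    rw [cc, cc]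
    exact congrArg (completionMap e · x) (funext fun a => h.c_comm i j a)
  · intro τ (x : B)
    refine IsCompl.eq_compl ⟨?_, ?_⟩
    · rw [disjoint_iff_inf_le]
      refine inf fun a b ha hb => ?_
      rw [← h.s_inf]
      have : e (a ⊓ b) ≤ e ⊥ := by
        rw [he.map_inf, he.map_bot]
        exact (disjoint_compl_left.mono ha hb).le_bot
      rw [le_bot_iff.1 (e.le_iff_le.1 this), h.s_bot, he.map_bot]
    · rw [codisjoint_iff]
      refine (sup τ _ _).symm.trans ?_
      rw [compl_sup_eq_top, ← he.map_top, completionMap_apply (h.s_mono τ), h.s_top]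
  · exact sup
  · intro (x : B)
    refine Eq.trans ?_ (he.eq_iSup x).symm
    exact iSup_congr fun a => congrArg e (h.s_one _)
  · intro σ τ x
    refine (ss σ (A.s τ) x).trans ?_
    exact congrArg (completionMap e · x) (funext fun a => h.s_comp σ τ a)
  · intro σ τ i hστ x
    refine (ss σ (A.c i) x).trans (Eq.trans ?_ (ss τ (A.c i) x).symm)
    exact congrArg (completionMap e · x) (funext fun a => h.s_c σ τ i hστ a)
  · intro τ i j hτ x
    refine (cc i (A.s τ) x).trans (Eq.trans ?_ (ss τ (A.c j) x).symm)
    exact congrArg (completionMap e · x) (funext fun a => h.c_s τ i j hτ a)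
  · intro τ i hτ x
    refine (cc i (A.s τ) x).trans ?_
    exact congrArg (completionMap e · x) (funext fun a => h.c_s_of_notMem τ i hτ a)
  · intro i
    exact (congrArg e (h.d_self i)).trans he.map_top
  · intro τ i j
    exact (completionMap_apply (h.s_mono τ) _).trans (congrArg e (h.s_d τ i j))
  · intro i j (x : B)
    refine he.le_of_forall fun a ha => ?_
    have h1 : a ≤ A.d i j := e.le_iff_le.1 (ha.trans inf_le_right)
    have h2 := h.inf_d_le i j a
    rw [inf_eq_left.2 h1] at h2
    exact (e.monotone h2).trans (le_completionMap (ha.trans inf_le_left))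

/-- The composition of the cylindrifiers with indices in `l`. -/
def cyls (A : PolyAlg.{u} ι) (l : List ι) (x : A.carrier) : A.carrier := l.foldr A.c x

theorem IsQPEA.le_cyls (h : A.IsQPEA) (l : List ι) (x : A.carrier) : x ≤ A.cyls l x := by
  induction l with
  | nil => exact le_rfl
  | cons i l ih => exact ih.trans (h.le_c i _)

theorem IsQPEA.c_cyls_of_fix (h : A.IsQPEA) {i : ι} {x : A.carrier} (hx : A.c i x = x)
    (l : List ι) : A.c i (A.cyls l x) = A.cyls l x := by
  induction l with
  | nil => exact hx
  | cons j l ih =>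
    show A.c i (A.c j _) = A.c j _
    rw [h.c_comm]
    exact congrArg (A.c j) ih

theorem IsQPEA.c_cyls_of_mem (h : A.IsQPEA) {i : ι} (x : A.carrier) {l : List ι} (hi : i ∈ l) :
    A.c i (A.cyls l x) = A.cyls l x := by
  induction l with
  | nil => simp at hi
  | cons j l ih =>
    show A.c i (A.c j _) = A.c j _
    rcases List.mem_cons.1 hi with rfl | hi
    · exact h.c_idem _ _
    · rw [h.c_comm]
      exact congrArg (A.c j) (ih hi)

theorem IsQPEA.cyls_le_of_fix (h : A.IsQPEA) {x z : A.carrier} {l : List ι} (hxz : x ≤ z)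
    (hz : ∀ i ∈ l, A.c i z = z) : A.cyls l x ≤ z := by
  induction l with
  | nil => exact hxz
  | cons i l ih =>
    rw [← hz i (by simp)]
    exact h.c_mono i (ih fun j hj => hz j (by simp [hj]))

/-- In a locally finite algebra, every element is below an element of the neat reduct that is
obtained by cylindrifying it. -/
theorem IsQPEA.exists_cyls_mem_neatSub {A : PolyAlg.{u} ℕ} (h : A.IsQPEA) (hA : A.LocallyFinite)
    (n : ℕ) (x : A.carrier) : ∃ l : List ℕ, (∀ i ∈ l, n ≤ i) ∧ A.cyls l x ∈ A.neatSub h n := by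
  refine ⟨((hA x).toFinset.filter (n ≤ ·)).toList, by simp, fun i hi => ?_⟩
  by_cases hx : A.c i x = x
  · exact h.c_cyls_of_fix hx _
  · exact h.c_cyls_of_mem x (by simp [hx, hi])

open IsBoolCompletion in
/-- A locally finite algebra with complete neat `n`-reduct has the same neat `n`-reduct as its
completion. -/
theorem IsQPEA.exists_complete {A : PolyAlg.{u} ℕ} (h : A.IsQPEA) (hA : A.LocallyFinite) (n : ℕ)
    (hn : (A.neatReduct h n).Complete) :
    ∃ (D : PolyAlg.{u} ℕ) (hD : D.IsQPEA), D.Complete ∧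
      (A.neatReduct h n).Iso (D.neatReduct hD n) := by
  obtain ⟨B, _, e, h1, h2, h3⟩ := exists_completion A.carrier
  have he : IsBoolCompletion e := ⟨h1, h2, h3⟩
  have ec (i : ℕ) (x : A.carrier) : (A.completion e).c i (e x) = e (A.c i x) :=
    completionMap_apply (fun _ _ => h.c_mono i) x
  refine ⟨A.completion e, h.completion he, fun S => ⟨_, isLUB_sSup (α := B) S⟩, ?_⟩
  let f : (A.neatReduct h n).carrier ↪o ((A.completion e).neatReduct (h.completion he) n).carrier :=
    OrderEmbedding.ofMapLEIff
      (fun x => ⟨e x.1, fun i hi => (ec i x.1).trans (congrArg e (x.2 i hi))⟩)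
      (fun x y => e.le_iff_le)
  have hf : Function.Surjective f := by
    rintro ⟨y, hy⟩
    -- The candidate preimage of `y` is the supremum, taken in the neat reduct, of the elements
    -- below `y`. It remains to see that this is also the supremum in the completion.
    obtain ⟨x, hx⟩ := hn {x | e x.1 ≤ y}
    have ecyls (l : List ℕ) (a : A.carrier) : e (A.cyls l a) = (A.completion e).cyls l (e a) := by
      induction l with
      | nil => rfl
      | cons i l ih => exact (ec i _).symm.trans (congrArg _ ih)
    refine ⟨x, Subtype.ext (le_antisymm ?_ ?_)⟩
    -- An upper bound `w` from `A` need not lie in the neat reduct; cylindrifying `wᶜ` and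
    -- complementing gives a smaller upper bound that does.
    · refine he.le_of_forall_ge fun w hw => e.monotone ?_
      obtain ⟨l, hl, hl'⟩ := h.exists_cyls_mem_neatSub hA n wᶜ
      have : x ≤ ⟨A.cyls l wᶜ, hl'⟩ᶜ := by
        refine hx.2 fun t ht => ?_
        have ht' : t.1 ≤ w := e.le_iff_le.1 (le_trans ht hw)
        show t.1 ≤ (A.cyls l wᶜ)ᶜ
        rw [le_compl_comm]
        exact h.cyls_le_of_fix (compl_le_compl ht') fun i hi =>
          h.c_compl_of_fix (t.2 i (hl i hi))
      have h4 : x.1 ≤ (A.cyls l wᶜ)ᶜ := this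
      exact h4.trans (compl_le_iff_compl_le.1 (h.le_cyls l wᶜ))
    -- As `y` is closed under the cylindrifiers beyond `n`, the closure of `a` in the neat reduct is
    -- still below `y`.
    · refine he.le_of_forall fun a ha => e.monotone ?_
      obtain ⟨l, hl, hl'⟩ := h.exists_cyls_mem_neatSub hA n a
      have h4 : (⟨A.cyls l a, hl'⟩ : (A.neatReduct h n).carrier) ≤ x := by
        refine hx.1 ?_
        show e (A.cyls l a) ≤ y
        rw [ecyls]
        exact (h.completion he).cyls_le_of_fix ha fun i hi => hy i (hl i hi)
      exact (h.le_cyls l a).trans h4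
  refine ⟨RelIso.ofSurjective f hf, fun i x => Subtype.ext (ec i x.1).symm,
    fun i j => rfl, fun τ x => Subtype.ext ?_⟩
  exact (completionMap_apply (h.s_mono τ.extend) x.1).symm

theorem Iso.trans {ι : Type v} {A B C : PolyAlg.{u} ι} (h : A.Iso B) (h' : B.Iso C) : A.Iso C := by
  obtain ⟨e, hc, hd, hs⟩ := h
  obtain ⟨e', hc', hd', hs'⟩ := h'
  exact ⟨e.trans e', fun i x => by simp [hc, hc'], fun i j => by simp [hd, hd'],
    fun τ x => by simp [hs, hs']⟩

theorem Iso.complete {ι : Type v} {A B : PolyAlg.{u} ι} (h : A.Iso B) (hA : A.Complete) : B.Complete := by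
  obtain ⟨e, -⟩ := h
  intro S
  obtain ⟨x, hx⟩ := hA (e ⁻¹' S)
  exact ⟨e x, e.isLUB_preimage.1 hx⟩

end PolyAlg

/-! ### Recovering the atom structure from its complex algebra. -/

namespace PolyAtomStr

variable {ι : Type v} {α : PolyAtomStr.{u} ι} {A : PolyAlg.{u} ι}

theorem complexAlg_complete (α : PolyAtomStr.{u} ι) : α.complexAlg.Complete :=
  fun S => ⟨_, isLUB_sSup (α := Set α.carrier) S⟩

theorem isAtomic_of_complexAlg_iso (h : α.complexAlg.Iso A) : IsAtomic A.carrier := by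
  obtain ⟨e, -⟩ := h
  exact e.isAtomic_iff.1 (inferInstanceAs (IsAtomic (Set α.carrier)))

theorem iso_atomStr_of_complexAlg_iso (h : α.complexAlg.Iso A) : α.Iso A.atomStr := by
  obtain ⟨e, hc, hd, hs⟩ := h
  have hat (a : α.carrier) : IsAtom (e {a}) := (e.isAtom_iff _).2 (Set.isAtom_singleton a)
  have hle (a : α.carrier) (S : Set α.carrier) : e {a} ≤ e S ↔ a ∈ S := by
    rw [e.le_iff_le]
    exact Set.singleton_subset_iff
  refine ⟨Equiv.ofBijective (fun a => ⟨e {a}, hat a⟩) ⟨?_, ?_⟩, ?_, ?_, ?_⟩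
  · intro a b hab
    exact Set.singleton_injective (e.injective (congrArg Subtype.val hab))
  · rintro ⟨x, hx⟩
    obtain ⟨S, rfl⟩ := e.surjective x
    obtain ⟨a, rfl⟩ := Set.isAtom_iff.1 ((e.isAtom_iff _).1 hx)
    exact ⟨a, rfl⟩
  · intro i a b
    show _ ↔ e {a} ≤ A.c i (e {b})
    rw [← hc, hle]
    simp
  · intro i j a
    show _ ↔ e {a} ≤ A.d i j
    rw [← hd, hle]
    rfl
  · intro τ a b
    show _ ↔ e {a} ≤ A.s τ (e {b})
    rw [← hs, hle]
    simp

end PolyAtomStr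

/-! ### Atom structures of polyadic equality algebras -/

namespace PolyAtomStr.IsPEAAtomStr

variable {n : ℕ} {α : PolyAtomStr.{u} (Fin n)}

theorem cyl_symm (hα : α.IsPEAAtomStr) {i : Fin n} {a b : α.carrier} (h : α.cyl i a b) :
    α.cyl i b a := by
  obtain ⟨A, hA, -, e, hc, -, -⟩ := hα
  rw [hc] at h ⊢
  refine ((e b).2.not_disjoint_iff_le).1 fun hd => (e a).2.1 ?_
  exact le_bot_iff.1 ((hA.disjoint_c hd) h le_rfl)

theorem sub_unique (hα : α.IsPEAAtomStr) {τ : FinTrans (Fin n)} {a b b' : α.carrier}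
    (h : α.sub τ a b) (h' : α.sub τ a b') : b = b' := by
  obtain ⟨A, hA, -, e, -, -, hs⟩ := hα
  rw [hs] at h h'
  by_contra hne
  have hd : Disjoint (e b).1 (e b').1 :=
    (e b).2.disjoint_of_ne (e b').2 fun h => hne (e.injective (Subtype.ext h))
  have h1 : (e a).1 ≤ A.s τ ((e b).1 ⊓ (e b').1) := by
    rw [hA.s_inf]
    exact le_inf h h'
  rw [hd.eq_bot, hA.s_bot] at h1
  exact (e a).2.1 (le_bot_iff.1 h1)

/-- As `s τ` is a Boolean endomorphism carrying diagonals to diagonals, an atom below `s τ b`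
decides a diagonal exactly as `b` does. -/
theorem sub_diag (hα : α.IsPEAAtomStr) {τ : FinTrans (Fin n)} {a b : α.carrier}
    (h : α.sub τ a b) (i j : Fin n) : α.diag i j b ↔ α.diag (τ.1 i) (τ.1 j) a := by
  obtain ⟨A, hA, -, e, -, hd, hs⟩ := hα
  rw [hs] at h
  rw [hd, hd]
  constructor
  · intro h1
    have h2 := le_trans h (hA.s_mono τ h1)
    rwa [hA.s_d] at h2
  · intro h1
    refine ((e b).2.not_disjoint_iff_le).1 fun h2 => (e a).2.1 ?_
    have h3 := le_trans h (hA.s_mono τ (le_compl_iff_disjoint_right.2 h2))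
    rw [hA.s_compl, hA.s_d] at h3
    exact le_bot_iff.1 ((le_inf h1 h3).trans_eq inf_compl_eq_bot)

theorem sub_one (hα : α.IsPEAAtomStr) (a : α.carrier) : α.sub (FinTrans.one _) a a := by
  obtain ⟨A, hA, -, e, -, -, hs⟩ := hα
  rw [hs]
  exact (hA.s_one _).ge

theorem sub_comp (hα : α.IsPEAAtomStr) {σ τ : FinTrans (Fin n)} {a b c : α.carrier}
    (h : α.sub σ a b) (h' : α.sub τ b c) : α.sub (σ.comp τ) a c := by
  obtain ⟨A, hA, -, e, -, -, hs⟩ := hα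
  rw [hs] at h h' ⊢
  exact (le_trans h (hA.s_mono σ h')).trans_eq (hA.s_comp _ _ _)

theorem sub_repl (hα : α.IsPEAAtomStr) {i j : Fin n} (hij : i ≠ j) {a b : α.carrier}
    (h : α.cyl i a b) (hd : α.diag i j b) : α.sub (FinTrans.repl i j) a b := by
  obtain ⟨A, hA, -, e, hc', hd', hs⟩ := hα
  rw [hs]
  rw [hc'] at h
  rw [hd'] at hd
  have h1 : A.c i (e b).1 ≤ A.s (FinTrans.repl i j) (e b).1 := by
    rw [hA.s_repl hij, inf_eq_right.2 hd]
  exact le_trans h h1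

end PolyAtomStr.IsPEAAtomStr

/-! ### Homogeneous models -/

section Models

variable {n : ℕ} {Λ : Type w} {X : Type u} {V : Type v}

/-- The relation `p` preserves the labels of `n`-tuples and of finite sequences. -/
def IsPartialIso (lab : (Fin n → V) → X) (hyp : List V → Λ) (p : Set (V × V)) : Prop :=
  (∀ z : Fin n → V × V, (∀ i, z i ∈ p) → lab (fun i => (z i).1) = lab (fun i => (z i).2)) ∧
  ∀ l : List (V × V), (∀ q ∈ l, q ∈ p) → hyp (l.map Prod.fst) = hyp (l.map Prod.snd)

/-- The tuple `(x, y, …, y)` is labelled by an atom below `d 0 1`. -/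
def LabelSim {α : PolyAtomStr.{u} (Fin n)} (lab : (Fin n → V) → α.carrier) (x y : V) : Prop :=
  ∃ i j : Fin n, (i : ℕ) = 0 ∧ (j : ℕ) = 1 ∧
    α.diag i j (lab fun k => if (k : ℕ) = 0 then x else y)

/-- A hypernetwork on a possibly infinite set of nodes that realizes all the atoms that are
compatible with its labels, and is homogeneous for finite partial isomorphisms. -/
structure IsHomogeneousModel (α : PolyAtomStr.{u} (Fin n)) (lam : Λ)
    (lab : (Fin n → V) → α.carrier) (hyp : List V → Λ) : Prop where
  cyl : ∀ x i e, α.cyl i (lab (Function.update x i e)) (lab x)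
  diag : ∀ x i j, α.diag i j (lab (Function.update x i (x j)))
  sub : ∀ τ x, α.sub τ (lab x) (lab (x ∘ τ.1))
  lab_congr : ∀ x y, (∀ i, LabelSim lab (x i) (y i)) → lab x = lab y
  hyp_congr : ∀ xs ys, List.Forall₂ (LabelSim lab) xs ys → hyp xs = hyp ys
  hyp_short : ∀ (y : Fin n → V) (xs : List V), (∀ v ∈ xs, ∃ j, v = y j) → hyp xs = lam
  saturated : ∀ x l b, α.cyl l b (lab x) → ∃ e, lab (Function.update x l e) = b
  homogeneous : ∀ p : Finset (V × V), IsPartialIso lab hyp p → ∀ d, ∃ e,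
    IsPartialIso lab hyp (insert (d, e) p)

namespace IsPartialIso

variable {lab : (Fin n → V) → X} {hyp : List V → Λ} {p q : Set (V × V)}

theorem mono (h : IsPartialIso lab hyp p) (hqp : q ⊆ p) : IsPartialIso lab hyp q :=
  ⟨fun z hz => h.1 z fun i => hqp (hz i), fun l hl => h.2 l fun x hx => hqp (hl x hx)⟩

theorem symm (h : IsPartialIso lab hyp p) : IsPartialIso lab hyp (Prod.swap '' p) := by
  constructor
  · intro z hz
    refine (h.1 (fun i => (z i).swap) fun i => ?_).symm
    obtain ⟨x, hx, hxz⟩ := hz i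
    rwa [← hxz, Prod.swap_swap]
  · intro l hl
    have := h.2 (l.map Prod.swap) (by
      intro x hx
      obtain ⟨y, hy, rfl⟩ := List.mem_map.1 hx
      obtain ⟨x, hx, rfl⟩ := hl y hy
      rwa [Prod.swap_swap])
    rw [List.map_map, List.map_map] at this
    exact this.symm

theorem of_eq (h : ∀ x ∈ p, x.1 = x.2) : IsPartialIso lab hyp p := by
  constructor
  · exact fun z hz => congrArg lab (funext fun i => h _ (hz i))
  · exact fun l hl => congrArg hyp (List.map_congr_left fun x hx => h x (hl x hx))

end IsPartialIso

namespace IsHomogeneousModel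

variable {α : PolyAtomStr.{u} (Fin n)} {lam : Λ} {lab : (Fin n → V) → α.carrier}
  {hyp : List V → Λ}

theorem labelSim_refl (h : IsHomogeneousModel α lam lab hyp) (hn : 1 < n) (x : V) :
    LabelSim lab x x := by
  refine ⟨⟨0, by omega⟩, ⟨1, hn⟩, rfl, rfl, ?_⟩
  have := h.diag (fun _ => x) ⟨0, by omega⟩ ⟨1, hn⟩
  simpa using this

theorem isPartialIso_of_labelSim (h : IsHomogeneousModel α lam lab hyp) {p : Set (V × V)}
    (hp : ∀ x ∈ p, LabelSim lab x.1 x.2) : IsPartialIso lab hyp p := by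
  refine ⟨fun z hz => h.lab_congr _ _ fun i => hp _ (hz i), fun l hl => h.hyp_congr _ _ ?_⟩
  rw [List.forall₂_map_left_iff, List.forall₂_map_right_iff, List.forall₂_same]
  exact fun x hx => hp x (hl x hx)

/-- The tuple `(x i, x j, …, x j)` is obtained from `x` by a substitution, and `sub_diag` transfers
the diagonal along it. -/
theorem labelSim_iff_diag (h : IsHomogeneousModel α lam lab hyp) (hα : α.IsPEAAtomStr)
    (hn : 1 < n) (x : Fin n → V) (i j : Fin n) :
    LabelSim lab (x i) (x j) ↔ α.diag i j (lab x) := by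
  let τ : FinTrans (Fin n) := ⟨fun k => if (k : ℕ) = 0 then i else j, Set.toFinite _⟩
  have hτ : x ∘ τ.1 = fun k : Fin n => if (k : ℕ) = 0 then x i else x j := by
    funext k
    exact apply_ite x _ _ _
  have h1 := hα.sub_diag (h.sub τ x) ⟨0, by omega⟩ ⟨1, hn⟩
  rw [hτ] at h1
  have h2 : α.diag i j (lab x) ↔ α.diag ⟨0, by omega⟩ ⟨1, hn⟩
      (lab fun k : Fin n => if (k : ℕ) = 0 then x i else x j) := by
    rw [h1]
    rfl
  rw [h2]
  constructor
  · rintro ⟨k, l, hk, hl, h3⟩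
    rwa [show k = ⟨0, by omega⟩ from Fin.ext hk, show l = ⟨1, hn⟩ from Fin.ext hl] at h3
  · exact fun h3 => ⟨_, _, rfl, rfl, h3⟩

theorem labelSim_of_isPartialIso
    {x y x' y' : V} (h : IsPartialIso lab hyp {(x, x'), (y, y')}) (hxy : LabelSim lab x y) :
    LabelSim lab x' y' := by
  obtain ⟨i, j, hi, hj, hd⟩ := hxy
  refine ⟨i, j, hi, hj, ?_⟩
  have h1 := h.1 (fun k => if (k : ℕ) = 0 then (x, x') else (y, y'))
    (by intro k; split_ifs <;> simp)
  simp only [apply_ite Prod.fst, apply_ite Prod.snd] at h1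
  rwa [h1] at hd

/-- Tuples with the same label are partially isomorphic. -/
theorem isPartialIso_of_lab_eq (h : IsHomogeneousModel α lam lab hyp) (hα : α.IsPEAAtomStr)
    {x y : Fin n → V} (hxy : lab x = lab y) :
    IsPartialIso lab hyp (Set.range fun i => (x i, y i)) := by
  constructor
  -- Pairs drawn from the range amount to a substitution `τ` applied to `x` and to `y`, and the
  -- label of a tuple determines that of its composite with `τ`.
  · intro z hz
    choose t ht using hz
    let τ : FinTrans (Fin n) := ⟨t, Set.toFinite _⟩
    have h1 := h.sub τ x
    rw [hxy] at h1
    have h2 := hα.sub_unique h1 (h.sub τ y)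
    simp only [← ht]
    exact h2
  -- Sequences of entries of one `n`-tuple are short, so both hyperlabels are `lam`; this is the use
  -- of neatness.
  · intro l hl
    rw [h.hyp_short x, h.hyp_short y]
    · intro v hv
      obtain ⟨q, hq, rfl⟩ := List.mem_map.1 hv
      obtain ⟨j, rfl⟩ := hl q hq
      exact ⟨j, rfl⟩
    · intro v hv
      obtain ⟨q, hq, rfl⟩ := List.mem_map.1 hv
      obtain ⟨j, rfl⟩ := hl q hq
      exact ⟨j, rfl⟩

end IsHomogeneousModel

end Models

/-! ### The locally finite algebra of a family of homogeneous models -/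

section ModelAlgebra

variable {n : ℕ} {Λ : Type w} {C : Type u} {V : C → Type} {α : PolyAtomStr.{u} (Fin n)}
  {lam : Λ}

/-- Membership in `X` depends only on the isomorphism type of the assignment on `S`. -/
def Supports (lab : ∀ c, (Fin n → V c) → α.carrier) (hyp : ∀ c, List (V c) → Λ) (S : Finset ℕ)
    (X : Set (Σ c, ℕ → V c)) : Prop :=
  ∀ c (f g : ℕ → V c), IsPartialIso (lab c) (hyp c) ((fun s => (f s, g s)) '' S) →
    (⟨c, f⟩ : Σ c, ℕ → V c) ∈ X → (⟨c, g⟩ : Σ c, ℕ → V c) ∈ X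

/-- The cylindrification of a set of assignments. -/
def cylSet (i : ℕ) (X : Set (Σ c, ℕ → V c)) : Set (Σ c, ℕ → V c) :=
  {a | ∃ e, (⟨a.1, Function.update a.2 i e⟩ : Σ c, ℕ → V c) ∈ X}

namespace Supports

variable {lab : ∀ c, (Fin n → V c) → α.carrier} {hyp : ∀ c, List (V c) → Λ} {S T : Finset ℕ}
  {X Y : Set (Σ c, ℕ → V c)}

theorem mono (h : Supports lab hyp S X) (hST : S ⊆ T) : Supports lab hyp T X :=
  fun c f g hfg => h c f g (hfg.mono (Set.image_mono (by exact_mod_cast hST)))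

theorem compl (h : Supports lab hyp S X) : Supports lab hyp S Xᶜ := by
  intro c f g hfg hf hg
  refine hf (h c g f ?_ hg)
  have := hfg.symm
  rwa [Set.image_image] at this

theorem inf (h : Supports lab hyp S X) (h' : Supports lab hyp T Y) :
    Supports lab hyp (S ∪ T) (X ∩ Y) := fun c f g hfg hf =>
  ⟨h.mono Finset.subset_union_left c f g hfg hf.1,
    h'.mono Finset.subset_union_right c f g hfg hf.2⟩

theorem sup (h : Supports lab hyp S X) (h' : Supports lab hyp T Y) :
    Supports lab hyp (S ∪ T) (X ∪ Y) := fun c f g hfg hf =>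
  hf.imp (h.mono Finset.subset_union_left c f g hfg)
    (h'.mono Finset.subset_union_right c f g hfg)

/-- A witness for `f` is carried to a witness for `g` by extending the partial isomorphism between
the remaining coordinates, which is what homogeneity provides. -/
theorem cyl (hM : ∀ c, IsHomogeneousModel α lam (lab c) (hyp c)) (h : Supports lab hyp S X)
    (i : ℕ) : Supports lab hyp (S.erase i) (cylSet i X) := by
  classical
  rintro c f g hfg ⟨d, hd⟩
  obtain ⟨e, he⟩ := (hM c).homogeneous ((S.erase i).image fun s => (f s, g s))
    (by rwa [Finset.coe_image]) d
  refine ⟨e, h c _ _ (he.mono ?_) hd⟩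
  rintro _ ⟨s, hs, rfl⟩
  by_cases hsi : s = i
  · subst hsi
    simp
  · simp only [Function.update_of_ne hsi]
    refine Or.inr ?_
    simp only [Finset.coe_image, Set.mem_image]
    exact ⟨s, by simpa [hsi] using hs, rfl⟩

theorem cylSet_eq (h : Supports lab hyp S X) {i : ℕ} (hi : i ∉ S) : cylSet i X = X := by
  apply subset_antisymm
  · rintro ⟨c, f⟩ ⟨e, he⟩
    refine h c _ _ (IsPartialIso.of_eq ?_) he
    rintro _ ⟨s, hs, rfl⟩
    exact Function.update_of_ne (by rintro rfl; exact hi hs) _ _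
  · rintro ⟨c, f⟩ hf
    exact ⟨f i, by rwa [Function.update_eq_self]⟩

theorem sub (h : Supports lab hyp S X) (τ : ℕ → ℕ) :
    Supports lab hyp (S.image τ)
      {a | (⟨a.1, a.2 ∘ τ⟩ : Σ c, ℕ → V c) ∈ X} := by
  intro c f g hfg hf
  refine h c _ _ (hfg.mono ?_) hf
  rintro _ ⟨s, hs, rfl⟩
  exact ⟨τ s, by simpa using ⟨s, hs, rfl⟩, rfl⟩

theorem diag (i j : ℕ) :
    Supports lab hyp {i, j} {a | LabelSim (lab a.1) (a.2 i) (a.2 j)} := by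
  intro c f g hfg hf
  exact IsHomogeneousModel.labelSim_of_isPartialIso (hfg.mono (by
    rintro _ (rfl | rfl)
    · exact ⟨i, by simp, rfl⟩
    · exact ⟨j, by simp, rfl⟩)) hf

/-- A set that is closed under the cylindrifiers beyond `n` is supported on `n`. -/
theorem restrict (hM : ∀ c, IsHomogeneousModel α lam (lab c) (hyp c)) (h : Supports lab hyp S X)
    (m : ℕ) (hX : ∀ i, m ≤ i → cylSet i X = X) : Supports lab hyp (Finset.range m) X := by
  -- Each cylindrifier that fixes `X` allows its index to be erased from the support.
  have key (T : Finset ℕ) (hT : ∀ i ∈ T, m ≤ i) : Supports lab hyp (S \ T) X := by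
    induction T using Finset.induction_on with
    | empty => simpa using h
    | insert i T hi ih =>
      have h1 := (ih fun j hj => hT j (by simp [hj])).cyl hM i
      rw [hX i (hT i (by simp))] at h1
      rwa [← Finset.sdiff_insert] at h1
  refine (key (S.filter (m ≤ ·)) (by simp)).mono ?_
  intro i hi
  simp only [Finset.mem_sdiff, Finset.mem_filter, not_and, not_le] at hi
  exact Finset.mem_range.2 (hi.2 hi.1)

end Supports

variable (lab : ∀ c, (Fin n → V c) → α.carrier) (hyp : ∀ c, List (V c) → Λ)
  (hM : ∀ c, IsHomogeneousModel α lam (lab c) (hyp c))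

/-- The Boolean algebra of the finitely supported sets of assignments. -/
def finSupportSets : BooleanSubalgebra (Set (Σ c, ℕ → V c)) where
  carrier := {X | ∃ S, Supports lab hyp S X}
  supClosed' := by
    rintro X ⟨S, hS⟩ Y ⟨T, hT⟩
    exact ⟨_, hS.sup hT⟩
  infClosed' := by
    rintro X ⟨S, hS⟩ Y ⟨T, hT⟩
    exact ⟨_, hS.inf hT⟩
  compl_mem' := by
    rintro X ⟨S, hS⟩
    exact ⟨S, hS.compl⟩
  bot_mem' := ⟨∅, fun _ _ _ _ h => h⟩

/-- The algebra of the finitely supported sets of assignments. -/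
abbrev modelAlg : PolyAlg.{u} ℕ where
  carrier := finSupportSets lab hyp
  c i X := ⟨cylSet i X.1, X.2.elim fun _ hS => ⟨_, hS.cyl hM i⟩⟩
  d i j := ⟨{a | LabelSim (lab a.1) (a.2 i) (a.2 j)}, ⟨_, Supports.diag i j⟩⟩
  s τ X := ⟨{a | (⟨a.1, a.2 ∘ τ.1⟩ : Σ c, ℕ → V c) ∈ X.1},
    X.2.elim fun _ hS => ⟨_, hS.sub τ.1⟩⟩

/-- The axioms hold pointwise as in any set algebra of assignments, except that diagonals mean `∼`
and not equality. Thus `inf_d_le` needs that elements are supported sets, which cannot distinguish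
`∼`-equivalent assignments. -/
theorem modelAlg_isQPEA (hn : 1 < n) : (modelAlg lab hyp hM).IsQPEA where
  c_bot i := by
    apply Subtype.ext
    ext a
    exact ⟨fun ⟨_, he⟩ => he, False.elim⟩
  le_c i X := by
    rintro ⟨c, f⟩ hf
    exact ⟨f i, by rwa [Function.update_eq_self]⟩
  c_inf i X Y := by
    apply Subtype.ext
    ext ⟨c, f⟩
    constructor
    · rintro ⟨e, h1, e', h2⟩
      rw [Function.update_idem] at h2
      exact ⟨⟨e, h1⟩, ⟨e', h2⟩⟩
    · rintro ⟨⟨e, h1⟩, ⟨e', h2⟩⟩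
      refine ⟨e, h1, e', ?_⟩
      rwa [Function.update_idem]
  c_comm i j X := by
    apply Subtype.ext
    ext ⟨c, f⟩
    have key (i j : ℕ) (X : Set (Σ c, ℕ → V c)) (h : ⟨c, f⟩ ∈ cylSet i (cylSet j X)) :
        ⟨c, f⟩ ∈ cylSet j (cylSet i X) := by
      by_cases hij : i = j
      · subst hij
        exact h
      · obtain ⟨d, e, h⟩ := h
        exact ⟨e, d, by rwa [Function.update_comm hij] at h⟩
    exact ⟨key i j X.1, key j i X.1⟩
  s_compl τ X := rfl
  s_sup τ X Y := rfl
  s_one X := rfl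
  s_comp σ τ X := rfl
  s_c σ τ i h X := by
    apply Subtype.ext
    ext ⟨c, f⟩
    refine exists_congr fun e => ?_
    have : Function.update (f ∘ σ.1) i e = Function.update (f ∘ τ.1) i e := by
      funext k
      by_cases hk : k = i
      · subst hk; simp
      · simp [hk, h k hk]
    show (⟨c, Function.update (f ∘ σ.1) i e⟩ : Σ c, ℕ → V c) ∈ X.1 ↔
      (⟨c, Function.update (f ∘ τ.1) i e⟩ : Σ c, ℕ → V c) ∈ X.1
    rw [this]
  c_s τ i j h X := by
    apply Subtype.ext
    ext ⟨c, f⟩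
    refine exists_congr fun e => ?_
    have : Function.update f i e ∘ τ.1 = Function.update (f ∘ τ.1) j e := by
      funext k
      by_cases hk : k = j
      · subst hk; simp [(h k).2 rfl]
      · simp [hk, mt (h k).1 hk]
    show (⟨c, Function.update f i e ∘ τ.1⟩ : Σ c, ℕ → V c) ∈ X.1 ↔
      (⟨c, Function.update (f ∘ τ.1) j e⟩ : Σ c, ℕ → V c) ∈ X.1
    rw [this]
  c_s_of_notMem τ i h X := by
    apply Subtype.ext
    ext ⟨c, f⟩
    have (e : V c) : Function.update f i e ∘ τ.1 = f ∘ τ.1 := by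
      funext k
      simp [h k]
    show (∃ e, (⟨c, Function.update f i e ∘ τ.1⟩ : Σ c, ℕ → V c) ∈ X.1) ↔
      (⟨c, f ∘ τ.1⟩ : Σ c, ℕ → V c) ∈ X.1
    simp only [this]
    exact ⟨fun ⟨_, h⟩ => h, fun h => ⟨f 0, h⟩⟩
  d_self i := by
    apply Subtype.ext
    ext ⟨c, f⟩
    exact ⟨fun _ => trivial, fun _ => (hM c).labelSim_refl hn _⟩
  s_d τ i j := rfl
  inf_d_le i j X := by
    rintro ⟨c, f⟩ ⟨hf, hd⟩
    obtain ⟨S, hS⟩ := X.2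
    refine hS c f _ ((hM c).isPartialIso_of_labelSim ?_) hf
    rintro _ ⟨k, -, rfl⟩
    show LabelSim (lab c) (f k) (f ((FinTrans.repl i j).1 k))
    rw [FinTrans.repl_apply]
    split_ifs with hk
    · rw [hk]; exact hd
    · exact (hM c).labelSim_refl hn _

theorem modelAlg_locallyFinite : (modelAlg lab hyp hM).LocallyFinite := by
  rintro ⟨X, S, hS⟩
  refine S.finite_toSet.subset fun i hi => ?_
  by_contra h
  exact hi (Subtype.ext (hS.cylSet_eq h))

/-- The isomorphism takes a set of atoms to its preimage under the label `r` of the first `n`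
coordinates. It is onto because elements of the neat reduct are supported on these coordinates, and
assignments with equal labels lie in the same model and are partially isomorphic there. Saturation
makes it respect cylindrifiers. -/
theorem complexAlg_iso_neatReduct_modelAlg (hα : α.IsPEAAtomStr) (hn : 1 < n)
    (hinj : ∀ c c' x y, lab c x = lab c' y → c = c') (hsurj : ∀ a, ∃ c x, lab c x = a) :
    α.complexAlg.Iso ((modelAlg lab hyp hM).neatReduct (modelAlg_isQPEA lab hyp hM hn) n) := by
  let r (a : Σ c, ℕ → V c) : α.carrier := lab a.1 fun i => a.2 i
  have r_surj (b : α.carrier) : ∃ a, r a = b := by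
    obtain ⟨c, x, rfl⟩ := hsurj b
    exact ⟨⟨c, fun i => if h : i < n then x ⟨i, h⟩ else x ⟨0, by omega⟩⟩, by simp [r]⟩
  have supp {X : Set (Σ c, ℕ → V c)} {a a' : Σ c, ℕ → V c}
      (hX : Supports lab hyp (Finset.range n) X) (h : r a = r a') (ha : a ∈ X) : a' ∈ X := by
    obtain ⟨c, f⟩ := a
    obtain ⟨c', g⟩ := a'
    obtain rfl := hinj _ _ _ _ h
    refine hX c f g (((hM c).isPartialIso_of_lab_eq hα h).mono ?_) ha
    rintro _ ⟨s, hs, rfl⟩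
    exact ⟨⟨s, by simpa using hs⟩, rfl⟩
  have supp' (T : Set α.carrier) : Supports lab hyp (Finset.range n) (r ⁻¹' T) := by
    intro c f g hfg hf
    have : r ⟨c, f⟩ = r ⟨c, g⟩ := hfg.1 (fun i => (f i, g i)) fun i => ⟨i, by simp, rfl⟩
    rwa [Set.mem_preimage, ← this]
  let φ : Set α.carrier ↪o
      ((modelAlg lab hyp hM).neatReduct (modelAlg_isQPEA lab hyp hM hn) n).carrier :=
    OrderEmbedding.ofMapLEIff
      (fun T => ⟨⟨r ⁻¹' T, _, supp' T⟩, fun i hi =>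
        Subtype.ext ((supp' T).cylSet_eq (by simpa using hi))⟩)
      (fun T T' => Set.preimage_subset_preimage_iff (fun b _ => r_surj b))
  have hφ : Function.Surjective φ := by
    rintro ⟨⟨X, S, hS⟩, hX⟩
    have h1 : Supports lab hyp (Finset.range n) X :=
      hS.restrict hM n fun i hi => congrArg Subtype.val (hX i hi)
    refine ⟨r '' X, Subtype.ext (Subtype.ext ?_)⟩
    refine subset_antisymm ?_ (Set.subset_preimage_image r X)
    rintro a ⟨a', ha', h⟩
    exact supp h1 h ha'
  have upd {c : C} (f : ℕ → V c) (i : Fin n) (e : V c) :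
      r ⟨c, Function.update f i e⟩ = lab c (Function.update (fun j : Fin n => f j) i e) := by
    refine congrArg (lab c) (funext fun j => ?_)
    by_cases hj : j = i
    · subst hj; simp
    · simp [hj, Fin.val_ne_of_ne hj]
  refine ⟨RelIso.ofSurjective φ hφ, fun i T => ?_, fun i j => ?_, fun τ T => ?_⟩
  · apply Subtype.ext
    apply Subtype.ext
    ext ⟨c, f⟩
    show (∃ b ∈ T, α.cyl i (r ⟨c, f⟩) b) ↔ ∃ e, r ⟨c, Function.update f i e⟩ ∈ T
    constructor
    · rintro ⟨b, hb, h⟩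
      obtain ⟨e, rfl⟩ := (hM c).saturated _ _ _ (hα.cyl_symm h)
      exact ⟨e, by rwa [upd]⟩
    · rintro ⟨e, he⟩
      refine ⟨_, he, ?_⟩
      rw [upd]
      exact hα.cyl_symm ((hM c).cyl _ _ _)
  · apply Subtype.ext
    apply Subtype.ext
    ext ⟨c, f⟩
    exact ((hM c).labelSim_iff_diag hα hn (fun i => f i) i j).symm
  · apply Subtype.ext
    apply Subtype.ext
    ext ⟨c, f⟩
    have h1 : r ⟨c, f ∘ τ.extend.1⟩ = lab c ((fun i : Fin n => f i) ∘ τ.1) := by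
      refine congrArg (lab c) (funext fun j => ?_)
      simp [FinTrans.extend]
    show (∃ b ∈ T, α.sub τ (r ⟨c, f⟩) b) ↔ r ⟨c, f ∘ τ.extend.1⟩ ∈ T
    rw [h1]
    constructor
    · rintro ⟨b, hb, h⟩
      rwa [hα.sub_unique ((hM c).sub _ _) h]
    · exact fun h => ⟨_, h, (hM c).sub _ _⟩

end ModelAlgebra

/-! ### Plays -/

namespace OmegaGame

variable (G : OmegaGame.{u, v}) (σ : List (G.MoveA × G.MoveE) → G.MoveA → G.MoveE)

/-- The histories in which `∀` makes legal moves and `∃` follows the strategy `σ`. -/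
inductive IsPlay : List (G.MoveA × G.MoveE) → Prop
  | nil : IsPlay []
  | snoc {h m} : IsPlay h → G.legalA h m → IsPlay (h ++ [(m, σ h m)])

variable {G σ}

theorem history_congr {m m' : ℕ → G.MoveA} {r : ℕ} (h : ∀ t < r, m t = m' t) :
    G.history σ m r = G.history σ m' r := by
  induction r with
  | zero => rfl
  | succ r ih =>
    have h1 := ih fun t ht => h t (by omega)
    have h2 := h r (by omega)
    simp only [history, h1, h2]

/-- Winning is phrased with infinite sequences of moves; a finite play followed by the move `b` is a
prefix of such a sequence, and the moves after it are irrelevant. -/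
theorem IsPlay.exists_history {h : List (G.MoveA × G.MoveE)} (hh : IsPlay G σ h) (b : G.MoveA) :
    ∃ (m : ℕ → G.MoveA) (r : ℕ), m r = b ∧ G.history σ m r = h ∧
      ∀ t < r, G.legalA (G.history σ m t) (m t) := by
  induction hh generalizing b with
  | nil => exact ⟨fun _ => b, 0, rfl, rfl, by simp⟩
  | @snoc h a hh ha ih =>
    obtain ⟨m, r, hm, hr, hl⟩ := ih a
    have key (t : ℕ) (ht : t ≤ r + 1) :
        G.history σ (Function.update m (r + 1) b) t = G.history σ m t :=
      history_congr fun s hs => Function.update_of_ne (by omega) _ _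
    refine ⟨Function.update m (r + 1) b, r + 1, by simp, ?_, fun t ht => ?_⟩
    · rw [key _ le_rfl, history, hr, hm]
    · rw [key t ht.le, Function.update_of_ne ht.ne]
      rcases (Nat.lt_succ_iff_lt_or_eq.1 ht) with h1 | rfl
      · exact hl t h1
      · rwa [hr, hm]

theorem ExistsWins.exists_strategy (hG : G.ExistsWins) :
    ∃ σ : List (G.MoveA × G.MoveE) → G.MoveA → G.MoveE, ∀ h m, IsPlay G σ h → G.legalA h m →
      G.legalE h m (σ h m) := by
  obtain ⟨σ, hσ⟩ := hG
  refine ⟨σ, fun h b hh hb => ?_⟩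
  obtain ⟨m, r, hm, hr, hl⟩ := hh.exists_history b
  have h1 := hσ m r fun t ht => by
    rcases ht.lt_or_eq with h1 | rfl
    · exact hl t h1
    · rwa [hr, hm]
  rwa [hr, hm] at h1

end OmegaGame

/-! ### Hypernetworks played in the game -/

namespace HyperNet

variable {n : ℕ} {Λ : Type w} {X : Type u}

theorem AgreeOn.trans {S : Finset ℕ} {L M N : HyperNet n X Λ} (h : AgreeOn S L M)
    (h' : AgreeOn S M N) : AgreeOn S L N :=
  ⟨fun x hx => (h.1 x hx).trans (h'.1 x hx), fun x hx => (h.2 x hx).trans (h'.2 x hx)⟩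

theorem AgreeOn.mono {S T : Finset ℕ} {M N : HyperNet n X Λ} (h : AgreeOn T M N)
    (hST : S ⊆ T) : AgreeOn S M N :=
  ⟨fun x hx => h.1 x fun i => hST (hx i), fun x hx => h.2 x fun y hy => hST (hx y hy)⟩

theorem Extends.refl (N : HyperNet n X Λ) : N.Extends N :=
  ⟨subset_rfl, fun _ _ => rfl, fun _ _ => rfl⟩

theorem Extends.trans {L M N : HyperNet n X Λ} (h : L.Extends M) (h' : M.Extends N) :
    L.Extends N :=
  ⟨h'.1.trans h.1, (h.2.mono h'.1).trans h'.2⟩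

variable {α : PolyAtomStr.{u} (Fin n)} {N : HyperNet n α.carrier Λ}

/-- Networks prescribe substitutions only for transpositions. Replacements come from the
cylindrifier and diagonal conditions, and together these generate all transformations. -/
theorem IsNetwork.sub_label (hN : N.IsNetwork) (hα : α.IsPEAAtomStr) (τ : FinTrans (Fin n))
    (x : Fin n → ℕ) (hx : N.IsTuple x) : α.sub τ (N.label x) (N.label (x ∘ τ.1)) := by
  induction τ using FinTrans.induction generalizing x with
  | one => exact hα.sub_one _
  | comp σ τ hσ hτ => exact hα.sub_comp (hσ x hx) (hτ (x ∘ σ.1) fun i => hx _)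
  | repl i j hij =>
    have h1 : x ∘ (FinTrans.repl i j).1 = Function.update x i (x j) := by
      simp [FinTrans.repl, Function.comp_update]
    rw [h1]
    exact hα.sub_repl hij (hα.cyl_symm (hN.cyl x hx i _ (hx j))) (hN.diag x hx i j)
  | transp i j =>
    refine (hN.sub (x ∘ Equiv.swap i j) (fun k => hx _) i j (N.label x)).2 ?_
    congr 1
    funext k
    simp

theorem IsNetwork.sim_refl (hN : N.IsNetwork) (hn : 1 < n) {x : ℕ} (hx : x ∈ N.nodes) :
    N.Sim x x := by
  refine ⟨fun _ => x, ⟨0, by omega⟩, ⟨1, hn⟩, fun _ => hx, rfl, rfl, rfl, rfl, ?_⟩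
  simpa using hN.diag (fun _ => x) (fun _ => hx) ⟨0, by omega⟩ ⟨1, hn⟩

/-- Two nodes that are related to the same node by a partial isomorphism are `∼`. -/
theorem IsNetwork.sim_of_isPartialIso (hN : N.IsNetwork) (hn : 1 < n) {p : Set (ℕ × ℕ)}
    (hp : IsPartialIso N.label N.hyper p) (hp' : ∀ q ∈ p, q.1 ∈ N.nodes ∧ q.2 ∈ N.nodes)
    {x y z : ℕ} (hx : (x, z) ∈ p) (hy : (y, z) ∈ p) : N.Sim x y := by
  have h1 := hp.1 (fun k => if (k : ℕ) = 0 then (x, z) else (y, z))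
    (by intro k; split_ifs <;> assumption)
  refine ⟨fun k => if (k : ℕ) = 0 then x else y, ⟨0, by omega⟩, ⟨1, hn⟩, ?_, rfl, rfl, rfl, rfl, ?_⟩
  · intro k
    dsimp only
    split_ifs
    exacts [(hp' _ hx).1, (hp' _ hy).1]
  · simp only [apply_ite Prod.fst, apply_ite Prod.snd, ite_self] at h1
    rw [h1]
    simpa using hN.diag (fun _ => z) (fun _ => (hp' _ hx).2) ⟨0, by omega⟩ ⟨1, hn⟩

end HyperNet

/-- A set of `lam`-neat hypernetworks, such as the hypernetworks played in the game `J`, in which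
cylindrifier requests and extension requests for partial isomorphisms can be met. -/
structure IsSaturating {n : ℕ} {Λ : Type w} (α : PolyAtomStr.{u} (Fin n)) (lam : Λ)
    (P : HyperNet n α.carrier Λ → Prop) : Prop where
  neat : ∀ N, P N → N.IsNeat lam
  exists_label : ∀ a, ∃ N, P N ∧ ∃ x, N.IsTuple x ∧ N.label x = a
  exists_cyl : ∀ N, P N → ∀ f l b, N.IsTuple f → α.cyl l b (N.label f) → ∃ M, P M ∧
    M.Extends N ∧ ∃ e ∈ M.nodes, M.label (Function.update f l e) = b
  exists_iso : ∀ N, P N → ∀ (p : Finset (ℕ × ℕ)) d, p.Nonempty →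
    (∀ q ∈ p, q.1 ∈ N.nodes ∧ q.2 ∈ N.nodes) → IsPartialIso N.label N.hyper p → d ∈ N.nodes →
    ∃ M, P M ∧ M.Extends N ∧ ∃ e ∈ M.nodes, IsPartialIso M.label M.hyper (insert (d, e) p)

/-- The set consists of all hypernetworks occurring in some play against the strategy. To extend a
partial isomorphism `p` of `N`, a copy of `N` is glued to `N` along the second coordinates of `p`,
each identified with a partner under `p`; the copy of `d` is the new value. -/
theorem exists_isSaturating {n : ℕ} (hn : 1 < n) {Λ : Type w} (α : PolyAtomStr.{u} (Fin n))
    (lam : Λ) (hwin : (gameJ α Λ lam).ExistsWins) :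
    ∃ P : HyperNet n α.carrier Λ → Prop, IsSaturating α lam P := by
  obtain ⟨σ, hσ⟩ := hwin.exists_strategy
  have hneat (h) (hh : OmegaGame.IsPlay (gameJ α Λ lam) σ h) (N) (hN : JMove.Played h N) :
      N.IsNeat lam := by
    induction hh with
    | nil => simp [JMove.Played] at hN
    | @snoc h m hh hm ih =>
      rw [JMove.Played, List.map_append, List.mem_append] at hN
      rcases hN with hN | hN
      · exact ih hN
      · obtain rfl : N = σ h m := by simpa using hN
        exact (hσ h m hh hm).1
  have old (h N q) (hN : JMove.Played (n := n) (X := α.carrier) (Λ := Λ) h N) :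
      JMove.Played (h ++ [q]) N := by
    rw [JMove.Played, List.map_append]
    exact List.mem_append_left _ hN
  have new (h N m) : JMove.Played (X := α.carrier) (Λ := Λ) (n := n) (h ++ [(m, N)]) N := by
    simp [JMove.Played]
  refine ⟨fun N => ∃ h, OmegaGame.IsPlay (gameJ α Λ lam) σ h ∧ JMove.Played h N, ?_, ?_, ?_, ?_⟩
  · rintro N ⟨h, hh, hN⟩
    exact hneat h hh N hN
  · intro a
    have h1 : (gameJ α Λ lam).legalA [] (.initial a) := rfl
    obtain ⟨h2, h3⟩ := hσ _ _ .nil h1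
    exact ⟨_, ⟨_, .snoc .nil h1, new _ _ _⟩, h3⟩
  · rintro N ⟨h, hh, hN⟩ f l b hf hb
    obtain ⟨k, hk⟩ := Infinite.exists_notMem_finset N.nodes
    have h1 : (gameJ α Λ lam).legalA h (.cylindrifier N f l k b) := ⟨hN, hf, hk, hb⟩
    obtain ⟨h2, h3, h4, h5⟩ := hσ _ _ hh h1
    exact ⟨_, ⟨_, .snoc hh h1, new _ _ _⟩, h3, k, by rw [h4]; simp, h5⟩
  · rintro N ⟨h, hh, hN⟩ p d ⟨q0, hq0⟩ hp hiso hd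
    classical
    obtain ⟨⟨hnet, -⟩, -⟩ := id (hneat h hh N hN)
    have hyp' := (hneat h hh N hN).1
    -- A shift by `B` moves every node of `N` to a fresh number.
    let B := N.nodes.sup id + 1
    have hB {v : ℕ} (hv : v ∈ N.nodes) : v < B :=
      Nat.lt_succ_of_le (Finset.le_sup (f := id) hv)
    -- As `p` is only a relation, `θ` chooses a partner for each second coordinate. Elsewhere it
    -- undoes the shift.
    have hex (v : ℕ) : ∃ u, (v ∈ p.image Prod.snd → (u, v) ∈ p) ∧
        (v ∉ p.image Prod.snd → u = v - B) := by
      by_cases hv : v ∈ p.image Prod.snd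
      · obtain ⟨⟨u, v'⟩, huv, rfl⟩ := Finset.mem_image.1 hv
        exact ⟨u, fun _ => huv, fun h => (h hv).elim⟩
      · exact ⟨v - B, fun h => (hv h).elim, fun _ => rfl⟩
    choose θ hθ1 hθ2 using hex
    have hG {v : ℕ} (hv : v ∈ p.image Prod.snd) : v ∈ N.nodes := by
      obtain ⟨q, hq, rfl⟩ := Finset.mem_image.1 hv
      exact (hp q hq).2
    have hθB (v : ℕ) : θ (v + B) = v := by
      rw [hθ2, Nat.add_sub_cancel]
      intro hv
      have := hB (hG hv)
      omega
    let dom := p.image Prod.snd ∪ N.nodes.image (· + B)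
    have hdom : dom.image θ = N.nodes := by
      ext v
      simp only [dom, Finset.mem_image, Finset.mem_union]
      constructor
      · rintro ⟨w, hw | ⟨v, hv, rfl⟩, rfl⟩
        · exact (hp _ (hθ1 w (Finset.mem_image.2 hw))).1
        · rwa [hθB]
      · exact fun hv => ⟨v + B, Or.inr ⟨v, hv, rfl⟩, hθB v⟩
    have h1 : (gameJ α Λ lam).legalA h (.transformation N dom θ) := ⟨hN, hdom⟩
    obtain ⟨-, h2, h3, h4⟩ := hσ _ _ hh h1
    have hplay := OmegaGame.IsPlay.snoc hh h1
    set L := σ h (.transformation N dom θ) with hL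
    have hinter : N.nodes ∩ L.nodes = p.image Prod.snd := by
      rw [h2]
      ext v
      simp only [dom, Finset.mem_inter, Finset.mem_union]
      constructor
      · rintro ⟨hv, hv' | hv'⟩
        · exact hv'
        · obtain ⟨w, hw, rfl⟩ := Finset.mem_image.1 hv'
          have := hB hv
          omega
      · exact fun hv => ⟨hG hv, Or.inl hv⟩
    have h5 : (gameJ α Λ lam).legalA (h ++ [(.transformation N dom θ, L)])
        (.amalgamation N L) := by
      refine ⟨old _ _ _ hN, new _ _ _, ?_, ?_⟩
      -- Nonemptiness of `p` makes the two hypernetworks share a node, as the amalgamation move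
      -- requires.
      · rw [hinter]
        exact ⟨q0.2, Finset.mem_image_of_mem _ hq0⟩
      · rw [hinter]
        constructor
        · intro x hx
          rw [h3 x fun i => Finset.mem_union_left _ (hx i)]
          exact (hiso.1 (fun i => (θ (x i), x i)) fun i => hθ1 _ (hx i)).symm
        · intro xs hx
          rw [h4 xs fun y hy => Finset.mem_union_left _ (hx y hy)]
          have := hiso.2 (xs.map fun v => (θ v, v)) (by
            intro q hq
            obtain ⟨v, hv, rfl⟩ := List.mem_map.1 hq
            exact hθ1 v (hx v hv))
          simp only [List.map_map, Function.comp_def, List.map_id'] at this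
          exact this.symm
    obtain ⟨-, h6, h7, h8⟩ := hσ _ _ hplay h5
    set M := σ (h ++ [(.transformation N dom θ, L)]) (.amalgamation N L)
    -- The chosen partner of `q.2` may differ from `q.1`, but both are related to `q.2` by `p` and
    -- hence `∼`. Labels in the amalgam therefore agree by congruence in `N`.
    have hsim (q : ℕ × ℕ) (hq : q ∈ (insert (d, d + B) p : Set (ℕ × ℕ))) :
        N.Sim q.1 (θ q.2) ∧ q.1 ∈ N.nodes ∧ q.2 ∈ dom ∧ θ q.2 ∈ N.nodes := by
      rcases hq with rfl | hq
      · dsimp only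
        rw [hθB]
        exact ⟨hnet.sim_refl hn hd, hd,
          Finset.mem_union_right _ (Finset.mem_image.2 ⟨d, hd, rfl⟩), hd⟩
      · have h9 : q.2 ∈ p.image Prod.snd := Finset.mem_image_of_mem _ hq
        exact ⟨hnet.sim_of_isPartialIso hn hiso hp hq (hθ1 q.2 h9), (hp q hq).1,
          Finset.mem_union_left _ h9, (hp _ (hθ1 q.2 h9)).1⟩
    refine ⟨M, ⟨_, .snoc hplay h5, new _ _ _⟩, h6, d + B, ?_, ?_, ?_⟩
    · rw [h8, h2]
      exact Finset.mem_union_right _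
        (Finset.mem_union_right _ (Finset.mem_image.2 ⟨d, hd, rfl⟩))
    · intro z hz
      rw [h6.2.1 _ fun i => (hsim _ (hz i)).2.1,
        h7.2.1 _ fun i => by rw [h2]; exact (hsim _ (hz i)).2.2.1,
        h3 _ fun i => (hsim _ (hz i)).2.2.1]
      exact hyp'.label_congr _ _ (fun i => (hsim _ (hz i)).2.1)
        (fun i => (hsim _ (hz i)).2.2.2) fun i => (hsim _ (hz i)).1
    · intro l hl
      have hmem (f : ℕ × ℕ → ℕ) (S : Finset ℕ) (hf : ∀ q ∈ l, f q ∈ S) :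
          ∀ x ∈ l.map f, x ∈ S := by
        intro x hx
        obtain ⟨q, hq, rfl⟩ := List.mem_map.1 hx
        exact hf q hq
      rw [h6.2.2 _ (hmem _ _ fun q hq => (hsim q (hl q hq)).2.1),
        h7.2.2 _ (hmem _ _ fun q hq => by rw [h2]; exact (hsim q (hl q hq)).2.2.1),
        h4 _ (hmem _ _ fun q hq => (hsim q (hl q hq)).2.2.1), List.map_map]
      refine hyp'.hyper_congr _ _ (hmem _ _ fun q hq => (hsim q (hl q hq)).2.1)
        (hmem _ _ fun q hq => (hsim q (hl q hq)).2.2.2) ?_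
      rw [List.forall₂_map_left_iff, List.forall₂_map_right_iff, List.forall₂_same]
      exact fun q hq => (hsim q (hl q hq)).1

/-! ### Limits of chains of hypernetworks -/

theorem List.exists_map_eq_of_forall_mem_image {β : Type u} {γ : Type v} {f : β → γ} {p : Set β}
    {l : List γ} (h : ∀ x ∈ l, x ∈ f '' p) : ∃ l' : List β, (∀ q ∈ l', q ∈ p) ∧ l'.map f = l := by
  induction l with
  | nil => exact ⟨[], by simp, rfl⟩
  | cons a l ih =>
    obtain ⟨l', h1, h2⟩ := ih fun x hx => h x (by simp [hx])
    obtain ⟨b, hb, rfl⟩ := h a (by simp)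
    exact ⟨b :: l', by simpa [hb] using h1, by simp [h2]⟩

section Limit

open Filter

variable {n : ℕ} {Λ : Type w} {α : PolyAtomStr.{u} (Fin n)} {lam : Λ}

/-- This lets partial isomorphisms of the limit be tested at any stage of the chain that contains
all the nodes involved. -/
theorem isPartialIso_image_iff {X : Type u} {V : Type v} {V' : Type v} (f : V → V')
    {lab : (Fin n → V) → X} {hyp : List V → Λ} {lab' : (Fin n → V') → X} {hyp' : List V' → Λ}
    {p : Set (V × V)}
    (hlab : ∀ x : Fin n → V, (∀ i, ∃ q ∈ p, x i = q.1 ∨ x i = q.2) → lab x = lab' (f ∘ x))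
    (hhyp : ∀ xs : List V, (∀ x ∈ xs, ∃ q ∈ p, x = q.1 ∨ x = q.2) → hyp xs = hyp' (xs.map f)) :
    IsPartialIso lab' hyp' (Prod.map f f '' p) ↔ IsPartialIso lab hyp p := by
  have hl (g : V × V → V) (hg : ∀ q, g q = q.1 ∨ g q = q.2) (l : List (V × V))
      (hl : ∀ q ∈ l, q ∈ p) : hyp (l.map g) = hyp' ((l.map g).map f) := by
    refine hhyp _ fun x hx => ?_
    obtain ⟨q, hq, rfl⟩ := List.mem_map.1 hx
    exact ⟨q, hl q hq, hg q⟩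
  constructor
  · intro h
    refine ⟨fun z hz => ?_, fun l hlp => ?_⟩
    · rw [hlab _ fun i => ⟨z i, hz i, Or.inl rfl⟩, hlab _ fun i => ⟨z i, hz i, Or.inr rfl⟩]
      exact h.1 (fun i => Prod.map f f (z i)) fun i => ⟨z i, hz i, rfl⟩
    · rw [hl _ (fun _ => Or.inl rfl) l hlp, hl _ (fun _ => Or.inr rfl) l hlp]
      have := h.2 (l.map (Prod.map f f)) (by
        intro q hq
        obtain ⟨q', hq', rfl⟩ := List.mem_map.1 hq
        exact ⟨q', hlp q' hq', rfl⟩)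
      rw [List.map_map, List.map_map] at this ⊢
      exact this
  · intro h
    refine ⟨fun z hz => ?_, fun l hlp => ?_⟩
    · choose t ht htz using hz
      have := h.1 t ht
      rw [hlab _ fun i => ⟨t i, ht i, Or.inl rfl⟩, hlab _ fun i => ⟨t i, ht i, Or.inr rfl⟩] at this
      simp only [← htz]
      exact this
    · obtain ⟨l, hl', rfl⟩ := List.exists_map_eq_of_forall_mem_image hlp
      have := h.2 l hl'
      rw [hl _ (fun _ => Or.inl rfl) l hl', hl _ (fun _ => Or.inr rfl) l hl', List.map_map,
        List.map_map] at this
      rw [List.map_map, List.map_map]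
      exact this

/-- The limit of a chain of hypernetworks that meets every request is a homogeneous model. -/
theorem exists_isHomogeneousModel_of_chain (hn : 1 < n) (hα : α.IsPEAAtomStr)
    (F : ℕ → HyperNet n α.carrier Λ) (hF : ∀ t, (F t).IsNeat lam)
    (hchain : ∀ t, (F (t + 1)).Extends (F t))
    (hcyl : ∀ f l b, ∃ᶠ t in atTop, (F t).IsTuple f → α.cyl l b ((F t).label f) →
      ∃ e ∈ (F (t + 1)).nodes, (F (t + 1)).label (Function.update f l e) = b)
    (hiso : ∀ (p : Finset (ℕ × ℕ)) d, p.Nonempty → ∃ᶠ t in atTop,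
      (∀ q ∈ p, q.1 ∈ (F t).nodes ∧ q.2 ∈ (F t).nodes) →
      IsPartialIso (F t).label (F t).hyper p → d ∈ (F t).nodes →
      ∃ e ∈ (F (t + 1)).nodes, IsPartialIso (F (t + 1)).label (F (t + 1)).hyper
        (insert (d, e) p)) :
    ∃ (V : Type) (lab : (Fin n → V) → α.carrier) (hyp : List V → Λ),
      IsHomogeneousModel α lam lab hyp ∧
      ∀ x, (F 0).IsTuple x → ∃ x', lab x' = (F 0).label x := by
  classical
  have ext {s t : ℕ} (hst : s ≤ t) : (F t).Extends (F s) := by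
    induction t, hst using Nat.le_induction with
    | base => exact .refl _
    | succ t _ ih => exact (hchain t).trans ih
  let V := {v : ℕ // ∃ t, v ∈ (F t).nodes}
  have ev (v : V) : ∀ᶠ t in atTop, v.1 ∈ (F t).nodes := by
    obtain ⟨t, ht⟩ := v.2
    exact eventually_atTop.2 ⟨t, fun s hs => (ext hs).1 ht⟩
  have evx (x : Fin n → V) : ∀ᶠ t in atTop, ∀ i, (x i).1 ∈ (F t).nodes :=
    eventually_all.2 fun i => ev (x i)
  have evl (l : List V) : ∀ᶠ t in atTop, ∀ v ∈ l, v.1 ∈ (F t).nodes := by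
    have := (eventually_all_finite (l.finite_toSet)).2 fun v _ => ev v
    exact this
  have evp (p : Finset (V × V)) :
      ∀ᶠ t in atTop, ∀ q ∈ p, q.1.1 ∈ (F t).nodes ∧ q.2.1 ∈ (F t).nodes :=
    (eventually_all_finset p).2 fun q _ => (ev q.1).and (ev q.2)
  -- Labels are read off at some stage containing all the entries; since stages extend each other,
  -- the choice of stage does not matter.
  let lab (x : Fin n → V) : α.carrier := (F (evx x).exists.choose).label (Subtype.val ∘ x)
  let hyp (l : List V) : Λ := (F (evl l).exists.choose).hyper (l.map Subtype.val)
  have lab_eq (x : Fin n → V) (t : ℕ) (ht : ∀ i, (x i).1 ∈ (F t).nodes) :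
      lab x = (F t).label (Subtype.val ∘ x) := by
    have hs := (evx x).exists.choose_spec
    rcases le_total t (evx x).exists.choose with h | h
    · exact (ext h).2.1 _ ht
    · exact ((ext h).2.1 _ hs).symm
  have hyp_eq (l : List V) (t : ℕ) (ht : ∀ v ∈ l, v.1 ∈ (F t).nodes) :
      hyp l = (F t).hyper (l.map Subtype.val) := by
    have hs := (evl l).exists.choose_spec
    have key {r : ℕ} (hr : ∀ v ∈ l, v.1 ∈ (F r).nodes) :
        ∀ x ∈ l.map Subtype.val, x ∈ (F r).nodes := by
      intro x hx
      obtain ⟨v, hv, rfl⟩ := List.mem_map.1 hx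
      exact hr v hv
    rcases le_total t (evl l).exists.choose with h | h
    · exact (ext h).2.2 _ (key ht)
    · exact ((ext h).2.2 _ (key hs)).symm
  have upd (x : Fin n → V) (i : Fin n) (e : V) :
      Subtype.val ∘ Function.update x i e = Function.update (Subtype.val ∘ x) i e.1 :=
    Function.comp_update _ _ _ _
  have upd_mem {x : Fin n → V} {t : ℕ} (ht : ∀ i, (x i).1 ∈ (F t).nodes) (i : Fin n) {e : V}
      (he : e.1 ∈ (F t).nodes) (j : Fin n) : (Function.update x i e j).1 ∈ (F t).nodes := by
    by_cases hj : j = i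
    · subst hj; simpa using he
    · simpa [hj] using ht j
  have sim {x y : V} (h : LabelSim lab x y) {t : ℕ} (hx : x.1 ∈ (F t).nodes)
      (hy : y.1 ∈ (F t).nodes) : (F t).Sim x.1 y.1 := by
    obtain ⟨i, j, hi, hj, h⟩ := h
    have hz : ∀ k : Fin n, (if (k : ℕ) = 0 then x else y).1 ∈ (F t).nodes := by
      intro k
      split_ifs <;> assumption
    rw [lab_eq _ t hz] at h
    exact ⟨_, i, j, hz, hi, hj, by simp [hi], by simp [hj], h⟩
  have piso {p : Finset (V × V)} {t : ℕ} (ht : ∀ q ∈ p, q.1.1 ∈ (F t).nodes ∧ q.2.1 ∈ (F t).nodes) :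
      IsPartialIso (F t).label (F t).hyper (Prod.map Subtype.val Subtype.val '' (p : Set (V × V)))
        ↔ IsPartialIso lab hyp p := by
    have key (v : V) : (∃ q ∈ (p : Set (V × V)), v = q.1 ∨ v = q.2) → v.1 ∈ (F t).nodes := by
      rintro ⟨q, hq, rfl | rfl⟩
      exacts [(ht q hq).1, (ht q hq).2]
    exact isPartialIso_image_iff _ (fun x hx => lab_eq x t fun i => key _ (hx i))
      fun xs hx => hyp_eq xs t fun v hv => key v (hx v hv)
  refine ⟨V, lab, hyp, ⟨?_, ?_, ?_, ?_, ?_, ?_, ?_, ?_⟩, ?_⟩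
  · intro x i e
    obtain ⟨t, ht, he⟩ := ((evx x).and (ev e)).exists
    rw [lab_eq x t ht, lab_eq _ t (upd_mem ht i he), upd]
    exact (hF t).1.network.cyl _ ht i _ he
  · intro x i j
    obtain ⟨t, ht⟩ := (evx x).exists
    rw [lab_eq _ t (upd_mem ht i (ht j)), upd]
    exact (hF t).1.network.diag _ ht i j
  · intro τ x
    obtain ⟨t, ht⟩ := (evx x).exists
    rw [lab_eq x t ht, lab_eq (x ∘ τ.1) t fun i => ht (τ.1 i)]
    exact (hF t).1.network.sub_label hα τ _ ht
  · intro x y hxy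
    obtain ⟨t, hx, hy⟩ := ((evx x).and (evx y)).exists
    rw [lab_eq x t hx, lab_eq y t hy]
    exact (hF t).1.label_congr _ _ hx hy fun i => sim (hxy i) (hx i) (hy i)
  · intro xs ys hxy
    obtain ⟨t, hx, hy⟩ := ((evl xs).and (evl ys)).exists
    rw [hyp_eq xs t hx, hyp_eq ys t hy]
    refine (hF t).1.hyper_congr _ _ ?_ ?_ ?_
    · intro v hv
      obtain ⟨v', hv', rfl⟩ := List.mem_map.1 hv
      exact hx v' hv'
    · intro v hv
      obtain ⟨v', hv', rfl⟩ := List.mem_map.1 hv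
      exact hy v' hv'
    · rw [List.forall₂_map_left_iff, List.forall₂_map_right_iff]
      rw [List.forall₂_iff_get] at hxy ⊢
      exact ⟨hxy.1, fun i h1 h2 =>
        sim (hxy.2 i h1 h2) (hx _ (List.get_mem _ _)) (hy _ (List.get_mem _ _))⟩
  · intro y xs hxs
    obtain ⟨t, hy⟩ := (evx y).exists
    have hmem (v : V) (hv : v ∈ xs) : v.1 ∈ (F t).nodes := by
      obtain ⟨j, rfl⟩ := hxs v hv
      exact hy j
    rw [hyp_eq xs t hmem]
    refine (hF t).2 _ ?_ ⟨_, hy, ?_⟩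
    · intro v hv
      obtain ⟨v', hv', rfl⟩ := List.mem_map.1 hv
      exact hmem v' hv'
    · intro v hv
      obtain ⟨v', hv', rfl⟩ := List.mem_map.1 hv
      obtain ⟨j, rfl⟩ := hxs v' hv'
      exact ⟨j, (hF t).1.network.sim_refl hn (hy j)⟩
  · intro x l b hb
    -- The request is answered at infinitely many stages and its nodes are present from some stage
    -- on, so one stage has both.
    obtain ⟨t, h, ht⟩ := ((hcyl (Subtype.val ∘ x) l b).and_eventually (evx x)).exists
    rw [lab_eq x t ht] at hb
    obtain ⟨e, he, h1⟩ := h ht hb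
    refine ⟨⟨e, _, he⟩, ?_⟩
    rwa [lab_eq _ (t + 1) (upd_mem (fun i => (hchain t).1 (ht i)) l he), upd]
  · intro p hp d
    -- The empty map falls outside the requests, but the identity on `d` extends it.
    rcases p.eq_empty_or_nonempty with rfl | hne
    · exact ⟨d, .of_eq (by simp)⟩
    have hcoe (p : Finset (V × V)) : ((p.image (Prod.map Subtype.val Subtype.val) :
        Finset (ℕ × ℕ)) : Set (ℕ × ℕ)) = Prod.map Subtype.val Subtype.val '' (p : Set (V × V)) :=
      Finset.coe_image
    obtain ⟨t, h, hpt, hdt⟩ := ((hiso (p.image (Prod.map Subtype.val Subtype.val)) d.1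
      (hne.image _)).and_eventually ((evp p).and (ev d))).exists
    obtain ⟨e, he, h1⟩ := h (by
      intro q hq
      obtain ⟨q', hq', rfl⟩ := Finset.mem_image.1 hq
      exact hpt q' hq') (by rw [hcoe, piso hpt]; exact hp) hdt
    refine ⟨⟨e, _, he⟩, ?_⟩
    have h2 : ∀ q ∈ (insert (d, ⟨e, _, he⟩) p : Finset (V × V)),
        q.1.1 ∈ (F (t + 1)).nodes ∧ q.2.1 ∈ (F (t + 1)).nodes := by
      intro q hq
      rcases Finset.mem_insert.1 hq with rfl | hq
      · exact ⟨(hchain t).1 hdt, he⟩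
      · exact ⟨(hchain t).1 (hpt q hq).1, (hchain t).1 (hpt q hq).2⟩
    have h3 := (piso h2).1 (by
      rw [Finset.coe_insert, Set.image_insert_eq, ← hcoe]
      exact h1)
    rwa [Finset.coe_insert] at h3
  · intro x hx
    exact ⟨fun i => ⟨x i, 0, hx i⟩, lab_eq _ 0 hx⟩

/-- Every atom labels a tuple of a homogeneous model. -/
theorem IsSaturating.exists_isHomogeneousModel (hn : 1 < n) (hα : α.IsPEAAtomStr)
    [Countable α.carrier] {P : HyperNet n α.carrier Λ → Prop} (hP : IsSaturating α lam P)
    (a : α.carrier) :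
    ∃ (V : Type) (lab : (Fin n → V) → α.carrier) (hyp : List V → Λ),
      IsHomogeneousModel α lam lab hyp ∧ ∃ x, lab x = a := by
  obtain ⟨N₀, hN₀, x₀, hx₀, rfl⟩ := hP.exists_label a
  -- Requests range over all natural numbers, not only existing nodes, so a single enumeration
  -- serves every stage; a request that does not yet apply is answered vacuously.
  let R := ((Fin n → ℕ) × Fin n × α.carrier) ⊕ {p : Finset (ℕ × ℕ) // p.Nonempty} × ℕ
  have : Nonempty R := ⟨.inr ⟨⟨{(0, 0)}, by simp⟩, 0⟩⟩
  obtain ⟨req, hreq⟩ := exists_surjective_nat R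
  let Ans (N M : HyperNet n α.carrier Λ) : R → Prop
    | .inl (f, l, b) => N.IsTuple f → α.cyl l b (N.label f) →
        ∃ e ∈ M.nodes, M.label (Function.update f l e) = b
    | .inr (p, d) => (∀ q ∈ p.1, q.1 ∈ N.nodes ∧ q.2 ∈ N.nodes) →
        IsPartialIso N.label N.hyper p.1 → d ∈ N.nodes →
        ∃ e ∈ M.nodes, IsPartialIso M.label M.hyper (insert (d, e) p.1)
  have step (N : {N // P N}) (r : R) : ∃ M : {N // P N}, M.1.Extends N.1 ∧ Ans N.1 M.1 r := by
    obtain ⟨N, hN⟩ := N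
    rcases r with ⟨f, l, b⟩ | ⟨p, d⟩
    · by_cases h : N.IsTuple f ∧ α.cyl l b (N.label f)
      · obtain ⟨M, hM, h1, h2⟩ := hP.exists_cyl N hN f l b h.1 h.2
        exact ⟨⟨M, hM⟩, h1, fun _ _ => h2⟩
      · exact ⟨⟨N, hN⟩, .refl _, fun h1 h2 => (h ⟨h1, h2⟩).elim⟩
    · by_cases h : (∀ q ∈ p.1, q.1 ∈ N.nodes ∧ q.2 ∈ N.nodes) ∧
        IsPartialIso N.label N.hyper p.1 ∧ d ∈ N.nodes
      · obtain ⟨M, hM, h1, h2⟩ := hP.exists_iso N hN p.1 d p.2 h.1 h.2.1 h.2.2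
        exact ⟨⟨M, hM⟩, h1, fun _ _ _ => h2⟩
      · exact ⟨⟨N, hN⟩, .refl _, fun h1 h2 h3 => (h ⟨h1, h2, h3⟩).elim⟩
  choose next hnext hans using step
  -- Decoding `t` as a pair and using only its first component makes every request recur infinitely
  -- often.
  let F : ℕ → {N // P N} := fun t =>
    Nat.rec ⟨N₀, hN₀⟩ (fun t N => next N (req (Nat.unpair t).1)) t
  have freq (r : R) : ∃ᶠ t in atTop, Ans (F t).1 (F (t + 1)).1 r := by
    obtain ⟨k, rfl⟩ := hreq r
    refine frequently_atTop.2 fun s => ⟨Nat.pair k s, Nat.right_le_pair _ _, ?_⟩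
    have h : F (Nat.pair k s + 1) = next (F (Nat.pair k s)) (req k) :=
      congrArg (fun j : ℕ × ℕ => next (F (Nat.pair k s)) (req j.1)) (Nat.unpair_pair k s)
    rw [h]
    exact hans _ _
  obtain ⟨V, lab, hyp, h1, h2⟩ := exists_isHomogeneousModel_of_chain hn hα (fun t => (F t).1)
    (fun t => hP.neat _ (F t).2) (fun t => hnext _ _) (fun f l b => freq (.inl (f, l, b)))
    (fun p d hp => freq (.inr (⟨p, hp⟩, d)))
  exact ⟨V, lab, hyp, h1, h2 x₀ hx₀⟩

end Limit

/-! ### Connected components of the atom structure. -/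

section Components

variable {n : ℕ} {Λ : Type w} {α : PolyAtomStr.{u} (Fin n)} {lam : Λ}

/-- Two atoms are connected if they are linked by the accessibility relations of the
cylindrifiers. -/
def cylSetoid (α : PolyAtomStr.{u} (Fin n)) : Setoid α.carrier :=
  Relation.EqvGen.setoid fun a b => ∃ i, α.cyl i a b

namespace IsHomogeneousModel

variable {V : Type v} {lab : (Fin n → V) → α.carrier} {hyp : List V → Λ}

/-- One tuple is turned into the other by changing one coordinate at a time, and each change is a
step of a cylindrifier relation. -/
theorem cylSetoid_lab (h : IsHomogeneousModel α lam lab hyp) (x y : Fin n → V) :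
    cylSetoid α (lab x) (lab y) := by
  classical
  have key (S : Finset (Fin n)) :
      cylSetoid α (lab x) (lab fun i => if i ∈ S then y i else x i) := by
    induction S using Finset.induction_on with
    | empty => simp
    | insert j S hj ih =>
      refine (cylSetoid α).trans ih ((cylSetoid α).symm (.rel _ _ ⟨j, ?_⟩))
      have := h.cyl (fun i => if i ∈ S then y i else x i) j (y j)
      convert this using 2
      funext i
      by_cases hi : i = j
      · subst hi; simp
      · simp [hi]
  simpa using key Finset.univ

/-- Saturation passes realization along each cylindrifier step. Together with `cylSetoid_lab`, the
atoms realized in a model form exactly one class. -/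
theorem exists_lab_eq (h : IsHomogeneousModel α lam lab hyp) (hα : α.IsPEAAtomStr)
    {a b : α.carrier} (hab : cylSetoid α a b) : (∃ x, lab x = a) ↔ ∃ x, lab x = b := by
  induction hab with
  | rel a b hab =>
    obtain ⟨i, hi⟩ := hab
    constructor
    · rintro ⟨x, rfl⟩
      exact (h.saturated x i b (hα.cyl_symm hi)).imp' _ fun _ => id
    · rintro ⟨x, rfl⟩
      exact (h.saturated x i a hi).imp' _ fun _ => id
  | refl a => rfl
  | symm a b _ ih => exact ih.symm
  | trans a b c _ _ ih1 ih2 => exact ih1.trans ih2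

end IsHomogeneousModel

end Components

theorem mainTheorem10 {n : ℕ} (hn : 2 < n) (α : PolyAtomStr.{u} (Fin n))
    (hα : α.IsPEAAtomStr) (hcount : Countable α.carrier) (Λ : Type w) (lam : Λ)
    (hwin : (gameJ α Λ lam).ExistsWins) :
    (∃ (D : PolyAlg.{u} ℕ) (hD : D.IsQPEA), D.LocallyFinite ∧
      IsAtomic (D.neatReduct hD n).carrier ∧
      α.Iso (D.neatReduct hD n).atomStr ∧
      α.complexAlg.Iso (D.neatReduct hD n)) ∧
    (∃ (D : PolyAlg.{u} ℕ) (hD : D.IsQPEA), D.Complete ∧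
      IsAtomic (D.neatReduct hD n).carrier ∧
      α.Iso (D.neatReduct hD n).atomStr ∧
      α.complexAlg.Iso (D.neatReduct hD n)) := by
  have hn' : 1 < n := by omega
  obtain ⟨P, hP⟩ := exists_isSaturating hn' α lam hwin
  -- One model per class is needed because nothing relates tuples of different models: an atom
  -- realized in two of them would split into several elements of the neat reduct.
  let C := Quotient (cylSetoid α)
  choose V lab hyp hM x₀ hx₀ using fun c : C =>
    hP.exists_isHomogeneousModel hn' hα (Quotient.out c)
  have hc (c : C) (x : Fin n → V c) : Quotient.mk (cylSetoid α) (lab c x) = c := by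
    refine Eq.trans (Quotient.sound ?_) (Quotient.out_eq c)
    have := (hM c).cylSetoid_lab x (x₀ c)
    rwa [hx₀] at this
  have hinj (c c' : C) (x : Fin n → V c) (y : Fin n → V c') (h : lab c x = lab c' y) : c = c' := by
    rw [← hc c x, h, hc]
  have hsurj (a : α.carrier) : ∃ c x, lab c x = a :=
    ⟨Quotient.mk _ a, ((hM _).exists_lab_eq hα (Quotient.mk_out (s := cylSetoid α) a)).1
      ⟨_, hx₀ _⟩⟩
  have hiso := complexAlg_iso_neatReduct_modelAlg lab hyp hM hα hn' hinj hsurj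
  have hlf := modelAlg_locallyFinite lab hyp hM
  refine ⟨⟨_, _, hlf, PolyAtomStr.isAtomic_of_complexAlg_iso hiso,
    PolyAtomStr.iso_atomStr_of_complexAlg_iso hiso, hiso⟩, ?_⟩
  -- The neat reduct is complete, being isomorphic to a power set algebra, so passing to the
  -- completion leaves it unchanged up to isomorphism.
  obtain ⟨D, hD, hcomp, h⟩ := (modelAlg_isQPEA lab hyp hM hn').exists_complete hlf n
    (hiso.complete α.complexAlg_complete)
  have hiso' := hiso.trans h
  exact ⟨D, hD, hcomp, PolyAtomStr.isAtomic_of_complexAlg_iso hiso',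
    PolyAtomStr.iso_atomStr_of_complexAlg_iso hiso', hiso'⟩
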